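/- Let $k\ge 1$ be a fixed integer and $\beta\ge 0$ a fixed real number. For real order-$k$ tensors $\mathbf X,\mathbf Y\in\bigotimes^k\mathbb R^n$ put $\langle \mathbf X,\mathbf Y\rangle=\sum_{i_1,\dots,i_k}\mathbf X_{i_1\dots i_k}\mathbf Y_{i_1\dots i_k}$ and $$\|\mathbf X\|_{op}=\max\{\langle \mathbf X,\mathbf u_1\otimes\cdots\otimes \mathbf u_k\rangle:\ \mathbf u_j\in\mathbb R^n,\ \|\mathbf u_j\|_2\le 1\ \text{for all } j\}.$$ For every $n\ge 1$ let $\mathbf v_0=\mathbf v_0(n)\in\mathbb R^n$ be a deterministic vector with $\|\mathbf v_0\|_2=1$, let $\mathbf G\in\bigotimes^k\mathbb R^n$ be a random tensor whose $n^k$ entries are i.i.d. ${\sf N}(0,1)$, and let $$\mathbf X=\mathbf X_n=\beta\,\mathbf v_0^{\otimes k}+\mathbf Z,\qquad \mathbf Z=\frac1{k!}\sqrt{\frac kn}\sum_{\pi\in\mathfrak S_k}\mathbf G^{\pi},\qquad \mathbf G^\pi_{i_1\dots i_k}=\mathbf G_{i_{\pi(1)}\dots i_{\pi(k)}}$$ (the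 spiked tensor model). Then $\mathbb E\|\mathbf X_n\|_{op}<\infty$ for every $n\ge 1$, the maximum below is attained, and $$\limsup_{n\to\infty}\mathbb E\|\mathbf X_n\|_{op}\ \le\ \max_{\tau\ge 0}\left\{\beta\left(\frac{\tau}{\sqrt{1+\tau^2}}\right)^k+\frac{k}{\sqrt{1+\tau^2}}\right\}.$$ Moreover, for every $n\ge 1$ and every $s\ge 0$, $$\mathbb P\left(\big|\|\mathbf X_n\|_{op}-\mathbb E\|\mathbf X_n\|_{op}\big|\ge s\right)\le 2\,e^{-ns^2/(2k)}.$$ -/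

import Mathlib

open MeasureTheory ProbabilityTheory

namespace SpikedTensor

/-- Real tensors of order `k` over `ℝⁿ`, given by their coordinates. -/
abbrev Tensor (k n : ℕ) : Type := (Fin k → Fin n) → ℝ

/-- The inner product `⟨X, Y⟩ = ∑_{i₁,…,iₖ} X_{i₁…iₖ} Y_{i₁…iₖ}`. -/
def tinner {k n : ℕ} (X Y : Tensor k n) : ℝ := ∑ i, X i * Y i

/-- The outer product `u₁ ⊗ ⋯ ⊗ uₖ`. -/
def outer {k n : ℕ} (u : Fin k → EuclideanSpace ℝ (Fin n)) : Tensor k n :=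
  fun i => ∏ j, u j (i j)

/-- The outer power `v^{⊗k}`. -/
def outerPow (k : ℕ) {n : ℕ} (v : EuclideanSpace ℝ (Fin n)) : Tensor k n :=
  outer fun _ => v

/-- The tensor `X^π` with permuted indices. -/
def permute {k n : ℕ} (π : Equiv.Perm (Fin k)) (X : Tensor k n) : Tensor k n :=
  fun i => X (i ∘ π)

/-- The values `⟨X, u₁ ⊗ ⋯ ⊗ uₖ⟩` over all `u₁, …, uₖ` in the closed unit ball. -/
def opValues {k n : ℕ} (X : Tensor k n) : Set ℝ :=
  {r | ∃ u : Fin k → EuclideanSpace ℝ (Fin n), (∀ j, ‖u j‖ ≤ 1) ∧ r = tinner X (outer u)}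

/-- The operator (injective) norm of a tensor; the supremum is a maximum by
`isGreatest_opNorm`. -/
noncomputable def opNorm {k n : ℕ} (X : Tensor k n) : ℝ := sSup (opValues X)

theorem isGreatest_opNorm {k n : ℕ} (X : Tensor k n) : IsGreatest (opValues X) (opNorm X) := by
  have hc : IsCompact (opValues X) := by
    have h1 : IsCompact (Set.univ.pi fun _ : Fin k =>
        Metric.closedBall (0 : EuclideanSpace ℝ (Fin n)) 1) :=
      isCompact_univ_pi fun _ => isCompact_closedBall _ _
    have h2 : Continuous fun u : Fin k → EuclideanSpace ℝ (Fin n) => tinner X (outer u) := by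
      unfold tinner outer
      fun_prop
    have h3 := h1.image h2
    convert h3 using 1
    ext r
    simp only [opValues, Set.mem_ofPred_eq, Set.mem_image, Set.mem_pi, Set.mem_univ, true_imp_iff,
      mem_closedBall_zero_iff]
    exact ⟨fun ⟨u, hu, hr⟩ => ⟨u, hu, hr.symm⟩, fun ⟨u, hu, hr⟩ => ⟨u, hu, hr.symm⟩⟩
  have hne : (opValues X).Nonempty := ⟨_, fun _ => 0, fun _ => by simp, rfl⟩
  exact hc.isGreatest_sSup hne

/-- `G` is a random tensor with i.i.d. standard normal coordinates (no symmetry is imposed). -/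
def IsStdGaussianTensor {k n : ℕ} {Ω : Type*} [MeasurableSpace Ω] (G : Ω → Tensor k n)
    (P : Measure Ω) : Prop :=
  (∀ i, HasLaw (fun ω => G ω i) (gaussianReal 0 1) P) ∧ iIndepFun (fun i ω => G ω i) P

/-- The symmetric noise tensor `Z = (1/k!) √(k/n) ∑_π G^π` built from `G`. -/
noncomputable def symNoise {k n : ℕ} (G : Tensor k n) : Tensor k n :=
  (1 / (k.factorial : ℝ) * √((k : ℝ) / n)) • ∑ π : Equiv.Perm (Fin k), permute π G

/-- The spiked tensor `X = β v₀^{⊗k} + Z`, where `Z` is built from `G`. -/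
noncomputable def spiked {k n : ℕ} (β : ℝ) (v₀ : EuclideanSpace ℝ (Fin n)) (G : Tensor k n) :
    Tensor k n :=
  β • outerPow k v₀ + symNoise G

end SpikedTensor

/-!
A symmetric tensor attains its operator norm, up to sign, at a symmetric rank one tensor (Banach),
so `‖X‖_op` is the maximum of the Gaussian process `(ε, v) ↦ ε ⟨X, v^{⊗k}⟩` over signs `ε = ±1`
and unit vectors `v`. Since `ε (1 - ρᵏ) ≤ k (1 - ρ)` for `|ρ| ≤ 1`, the increments of its centred
part are dominated by those of `(k / √n) ⟨v, y⟩ + ε √(k / n) z` with `y` and `z` standard Gaussian,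
and the Sudakov–Fernique inequality bounds `E ‖X‖_op` by the expected maximum of the process with
this simpler noise. Splitting `v` into its component `ρ` along `v₀` and a remainder of length
`√(1 - ρ²)`, and using that `‖y‖` deviates from its mean, which is at most `√n`, by `O(1)`, that
maximum is at most `max_ρ (β ρᵏ + k √(1 - ρ²)) + O(1 / √n)`.

The tail bound is Gaussian concentration: `‖X‖_op` is `√(k / n)`-Lipschitz in `G`. Concentration is
obtained from a covariance inequality by interpolating along rotations `cos θ • x + sin θ • y` of
two independent copies and integrating the resulting differential inequality for the cumulant
generating function.
-/

namespace SpikedTensor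

open scoped RealInnerProductSpace NNReal Topology

section Interpolation

variable {Ω H : Type*} [MeasurableSpace Ω] {μ : Measure Ω} [NormedAddCommGroup H] {K : ℝ≥0}
  {f : H → ℝ} {p : ENNReal} {U V : Ω → H}

theorem memLp_comp_of_lipschitzWith [IsFiniteMeasure μ] (hK : LipschitzWith K f)
    (hU : MemLp U p μ) : MemLp (fun ω => f (U ω)) p μ := by
  have h : MemLp (fun ω => f (U ω) - f 0) p μ :=
    (hK.sub (LipschitzWith.const (f 0))).comp_memLp (sub_self _) hU
  simpa [Pi.add_def] using h.add (memLp_const (f 0))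

variable [NormedSpace ℝ H]

theorem norm_fderiv_apply_le_of_lipschitzWith (hK : LipschitzWith K f) (x v : H) :
    ‖fderiv ℝ f x v‖ ≤ K * ‖v‖ :=
  (fderiv ℝ f x).le_of_opNorm_le (norm_fderiv_le_of_lipschitz ℝ hK) v

theorem memLp_fderiv_apply (hf : ContDiff ℝ 1 f) (hK : LipschitzWith K f)
    (hU : AEStronglyMeasurable U μ) (hV : MemLp V p μ) :
    MemLp (fun ω => fderiv ℝ f (U ω) (V ω)) p μ :=
  hV.of_le_mul
    ((hf.continuous_fderiv_apply one_ne_zero).comp_aestronglyMeasurable (hU.prodMk hV.1))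
    (.of_forall fun _ => norm_fderiv_apply_le_of_lipschitzWith hK _ _)

theorem hasDerivAt_integral_comp_cos_add_sin_mul [IsFiniteMeasure μ] (hf : ContDiff ℝ 1 f)
    (hK : LipschitzWith K f) (hU : MemLp U 2 μ) (hV : MemLp V 2 μ) {w : Ω → ℝ}
    (hw : MemLp w 2 μ) (θ : ℝ) :
    HasDerivAt (fun θ => ∫ ω, f (Real.cos θ • U ω + Real.sin θ • V ω) * w ω ∂μ)
      (∫ ω, fderiv ℝ f (Real.cos θ • U ω + Real.sin θ • V ω)
        (-Real.sin θ • U ω + Real.cos θ • V ω) * w ω ∂μ) θ := by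
  have hUV (θ) : MemLp (fun ω => Real.cos θ • U ω + Real.sin θ • V ω) 2 μ :=
    (hU.const_smul _).add (hV.const_smul _)
  have hUV' : MemLp (fun ω => -Real.sin θ • U ω + Real.cos θ • V ω) 2 μ :=
    (hU.const_smul _).add (hV.const_smul _)
  have hint (θ) : Integrable (fun ω => f (Real.cos θ • U ω + Real.sin θ • V ω) * w ω) μ :=
    (memLp_comp_of_lipschitzWith hK (hUV θ)).integrable_mul hw
  have hbound (θ : ℝ) (ω) : ‖fderiv ℝ f (Real.cos θ • U ω + Real.sin θ • V ω)
      (-Real.sin θ • U ω + Real.cos θ • V ω) * w ω‖ ≤ K * (‖U ω‖ + ‖V ω‖) * ‖w ω‖ := by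
    rw [norm_mul]
    gcongr
    refine (norm_fderiv_apply_le_of_lipschitzWith hK _ _).trans ?_
    gcongr
    refine (norm_add_le _ _).trans (add_le_add ?_ ?_)
    · simpa [norm_smul] using mul_le_mul_of_nonneg_right (Real.abs_sin_le_one θ) (norm_nonneg _)
    · simpa [norm_smul] using mul_le_mul_of_nonneg_right (Real.abs_cos_le_one θ) (norm_nonneg _)
  refine (hasDerivAt_integral_of_dominated_loc_of_deriv_le Filter.univ_mem
    (.of_forall fun θ => (hint θ).1) (hint θ)
    (((memLp_fderiv_apply hf hK (hUV θ).1 hUV').integrable_mul hw).1)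
    (.of_forall fun ω θ _ => hbound θ ω)
    (((hU.norm.add hV.norm).const_mul _).integrable_mul hw.norm)
    (.of_forall fun ω θ _ => ?_)).2
  have hcurve : HasDerivAt (fun θ => Real.cos θ • U ω + Real.sin θ • V ω)
      (-Real.sin θ • U ω + Real.cos θ • V ω) θ :=
    ((Real.hasDerivAt_cos θ).smul_const _).add ((Real.hasDerivAt_sin θ).smul_const _)
  exact ((hf.differentiable one_ne_zero _).hasFDerivAt.comp_hasDerivAt θ hcurve).mul_const _

theorem fderiv_comp_const_add_smul (f : H → ℝ) (c : H) (r : ℝ) (x : H) :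
    fderiv ℝ (fun x => f (c + r • x)) x = r • fderiv ℝ f (c + r • x) := by
  rw [fderiv_comp_smul (f := fun y => f (c + y)), fderiv_comp_add_left]

theorem unrotate_fst (θ : ℝ) (x y : H) : Real.cos θ • (Real.cos θ • x + Real.sin θ • y) +
    -Real.sin θ • (-Real.sin θ • x + Real.cos θ • y) = x := by
  match_scalars
  · linear_combination Real.sin_sq_add_cos_sq θ
  · ring

theorem unrotate_snd (θ : ℝ) (x y : H) : Real.sin θ • (Real.cos θ • x + Real.sin θ • y) +
    Real.cos θ • (-Real.sin θ • x + Real.cos θ • y) = y := by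
  match_scalars
  · ring
  · linear_combination Real.sin_sq_add_cos_sq θ

end Interpolation

section GaussianIntegrationByParts

variable {E : Type*} [NormedAddCommGroup E] [InnerProductSpace ℝ E] [FiniteDimensional ℝ E]
  [MeasurableSpace E] [BorelSpace E] {K : ℝ≥0} {f : E → ℝ}

theorem integral_comp_rotation_stdGaussian {g : E × E → ℝ} (hg : Continuous g) (θ : ℝ) :
    ∫ z, g (Real.cos θ • z.1 + Real.sin θ • z.2, -Real.sin θ • z.1 + Real.cos θ • z.2)
      ∂(stdGaussian E).prod (stdGaussian E) = ∫ z, g z ∂(stdGaussian E).prod (stdGaussian E) := by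
  conv_rhs => rw [← IsGaussian.map_rotation_eq_self (μ := stdGaussian E) (by simp) θ]
  rw [integral_map (by fun_prop) hg.aestronglyMeasurable]
  simp only [ContinuousLinearMap.rotation_apply]

theorem memLp_inner_stdGaussian (d : E) : MemLp (fun x => ⟪d, x⟫) 2 (stdGaussian E) :=
  IsGaussian.memLp_two_id.const_inner d

theorem integral_inner_stdGaussian (d : E) : ∫ x, ⟪d, x⟫ ∂stdGaussian E = 0 :=
  integral_strongDual_stdGaussian (innerSL ℝ d)

theorem integral_inner_mul_inner_stdGaussian (c d : E) :
    ∫ x, ⟪c, x⟫ * ⟪d, x⟫ ∂stdGaussian E = ⟪c, d⟫ := by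
  have h := covarianceBilin_apply (IsGaussian.memLp_two_id (μ := stdGaussian E)) c d
  rw [covarianceBilin_stdGaussian, innerSL_apply_apply ℝ] at h
  simpa using h.symm

theorem integral_strongDual_mul_inner_stdGaussian (L : StrongDual ℝ E) (d : E) :
    ∫ x, L x * ⟪d, x⟫ ∂stdGaussian E = L d := by
  simpa using integral_inner_mul_inner_stdGaussian ((InnerProductSpace.toDual ℝ E).symm L) d

theorem integral_comp_cos_add_sin_mul_inner_stdGaussian (hK : LipschitzWith K f) (d : E) (θ : ℝ) :
    ∫ z, f (Real.cos θ • z.1 + Real.sin θ • z.2) * ⟪d, z.2⟫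
      ∂(stdGaussian E).prod (stdGaussian E) =
      Real.sin θ * ∫ x, f x * ⟪d, x⟫ ∂stdGaussian E := by
  set γ := stdGaussian E
  have hf₁ : MemLp (fun z : E × E => f z.1) 2 (γ.prod γ) :=
    memLp_comp_of_lipschitzWith hK (IsGaussian.memLp_two_id.comp_fst γ)
  have hcont : Continuous fun z : E × E =>
      f z.1 * ⟪d, Real.sin θ • z.1 + Real.cos θ • z.2⟫ := by
    have := hK.continuous
    fun_prop
  have hfst : ∫ z, f z.1 * ⟪d, z.1⟫ ∂γ.prod γ = ∫ x, f x * ⟪d, x⟫ ∂γ := by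
    simp [integral_fun_fst (fun x => f x * ⟪d, x⟫)]
  have hsnd : ∫ z, f z.1 * ⟪d, z.2⟫ ∂γ.prod γ = 0 := by
    rw [integral_prod_mul f (fun y => ⟪d, y⟫), integral_inner_stdGaussian, mul_zero]
  calc ∫ z, f (Real.cos θ • z.1 + Real.sin θ • z.2) * ⟪d, z.2⟫ ∂γ.prod γ
      = ∫ z, f z.1 * ⟪d, Real.sin θ • z.1 + Real.cos θ • z.2⟫ ∂γ.prod γ := by
        rw [← integral_comp_rotation_stdGaussian hcont θ]
        simp only [γ, unrotate_snd]
    _ = Real.sin θ * ∫ z, f z.1 * ⟪d, z.1⟫ ∂γ.prod γ +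
          Real.cos θ * ∫ z, f z.1 * ⟪d, z.2⟫ ∂γ.prod γ := by
        simp only [inner_add_right, inner_smul_right, mul_add, mul_left_comm (f _)]
        rw [integral_add, integral_const_mul, integral_const_mul]
        · exact (hf₁.integrable_mul ((memLp_inner_stdGaussian d).comp_fst γ)).const_mul _
        · exact (hf₁.integrable_mul ((memLp_inner_stdGaussian d).comp_snd γ)).const_mul _
    _ = Real.sin θ * ∫ x, f x * ⟪d, x⟫ ∂γ := by rw [hfst, hsnd, mul_zero, add_zero]

/- Both sides are the derivative at `θ = 0` of `E[f (cos θ A + sin θ B) ⟨d, B⟩]` for independent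
`A` and `B`. -/
theorem integral_mul_inner_stdGaussian (hf : ContDiff ℝ 1 f) (hK : LipschitzWith K f) (d : E) :
    ∫ x, f x * ⟪d, x⟫ ∂stdGaussian E = ∫ x, fderiv ℝ f x d ∂stdGaussian E := by
  set γ := stdGaussian E
  have hfst : MemLp (Prod.fst : E × E → E) 2 (γ.prod γ) := IsGaussian.memLp_two_id.comp_fst γ
  have hsnd : MemLp (Prod.snd : E × E → E) 2 (γ.prod γ) := IsGaussian.memLp_two_id.comp_snd γ
  have hderiv := hasDerivAt_integral_comp_cos_add_sin_mul hf hK hfst hsnd (hsnd.const_inner d) 0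
  simp only [γ, integral_comp_cos_add_sin_mul_inner_stdGaussian hK, Real.cos_zero, Real.sin_zero,
    one_smul, zero_smul, neg_zero, add_zero, zero_add] at hderiv
  rw [← one_mul (∫ x, f x * ⟪d, x⟫ ∂γ), ← Real.cos_zero,
    ((Real.hasDerivAt_sin 0).mul_const _).unique hderiv, integral_prod]
  · simp only [γ, integral_strongDual_mul_inner_stdGaussian]
  · exact (memLp_fderiv_apply hf hK hfst.1 hsnd).integrable_mul (hsnd.const_inner d)

end GaussianIntegrationByParts

section Covariance

variable {E : Type*} [NormedAddCommGroup E] [InnerProductSpace ℝ E] [FiniteDimensional ℝ E]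
  [MeasurableSpace E] [BorelSpace E] {K L : ℝ≥0} {f g : E → ℝ}

theorem abs_integral_strongDual_mul_stdGaussian_le (ℓ : StrongDual ℝ E) (hg : ContDiff ℝ 1 g)
    (hL : LipschitzWith L g) :
    |∫ x, ℓ x * g x ∂stdGaussian E| ≤ ‖ℓ‖ * ∫ x, ‖fderiv ℝ g x‖ ∂stdGaussian E := by
  set d := (InnerProductSpace.toDual ℝ E).symm ℓ
  have hint : Integrable (fun x => ‖fderiv ℝ g x‖) (stdGaussian E) :=
    .of_bound (hg.continuous_fderiv one_ne_zero).norm.aestronglyMeasurable (L : ℝ)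
      (.of_forall fun x => by simpa using norm_fderiv_le_of_lipschitz ℝ hL)
  calc |∫ x, ℓ x * g x ∂stdGaussian E|
      = |∫ x, fderiv ℝ g x d ∂stdGaussian E| := by
        rw [← integral_mul_inner_stdGaussian hg hL]
        simp only [d, InnerProductSpace.toDual_symm_apply, mul_comm]
    _ ≤ ∫ x, ‖fderiv ℝ g x‖ * ‖d‖ ∂stdGaussian E :=
        norm_integral_le_of_norm_le (hint.mul_const _)
          (.of_forall fun x => (fderiv ℝ g x).le_opNorm d)
    _ = ‖ℓ‖ * ∫ x, ‖fderiv ℝ g x‖ ∂stdGaussian E := by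
        rw [integral_mul_const, LinearIsometryEquiv.norm_map, mul_comm]

theorem abs_integral_strongDual_mul_comp_add_smul_stdGaussian_le (ℓ : StrongDual ℝ E)
    (hg : ContDiff ℝ 1 g) (hL : LipschitzWith L g) (x : E) (c : ℝ) :
    |∫ w, ℓ w * g (x + c • w) ∂stdGaussian E| ≤
      ‖ℓ‖ * (|c| * ∫ w, ‖fderiv ℝ g (x + c • w)‖ ∂stdGaussian E) := by
  have hdiff : ContDiff ℝ 1 fun w => g (x + c • w) := hg.comp (by fun_prop)
  have hlip : LipschitzWith (L * ‖c‖₊) fun w => g (x + c • w) := by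
    refine hL.comp ?_
    simpa using (LipschitzWith.const x).add (lipschitzWith_smul c)
  simpa only [fderiv_comp_const_add_smul, norm_smul, Real.norm_eq_abs, integral_const_mul] using
    abs_integral_strongDual_mul_stdGaussian_le ℓ hdiff hlip

theorem integral_comp_cos_sub_sin_stdGaussian {g : E → ℝ} (hg : Continuous g) (θ : ℝ) :
    ∫ z, g (Real.cos θ • z.1 + -Real.sin θ • z.2) ∂(stdGaussian E).prod (stdGaussian E) =
      ∫ x, g x ∂stdGaussian E := by
  have h := integral_comp_rotation_stdGaussian (E := E) (g := fun z => g z.1) (by fun_prop) (-θ)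
  simpa [integral_fun_fst] using h

theorem abs_integral_fderiv_rotation_mul_le (hf : ContDiff ℝ 1 f) (hK : LipschitzWith K f)
    (hg : ContDiff ℝ 1 g) (hL : LipschitzWith L g) (θ : ℝ) :
    |∫ z, fderiv ℝ f (Real.cos θ • z.1 + Real.sin θ • z.2)
        (-Real.sin θ • z.1 + Real.cos θ • z.2) * g z.1 ∂(stdGaussian E).prod (stdGaussian E)| ≤
      K * |Real.sin θ| * ∫ x, ‖fderiv ℝ g x‖ ∂stdGaussian E := by
  set γ := stdGaussian E
  have hfst : MemLp (Prod.fst : E × E → E) 2 (γ.prod γ) := IsGaussian.memLp_two_id.comp_fst γ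
  have hsnd : MemLp (Prod.snd : E × E → E) 2 (γ.prod γ) := IsGaussian.memLp_two_id.comp_snd γ
  have hdg : Continuous (fderiv ℝ g) := hg.continuous_fderiv one_ne_zero
  have hcont : Continuous fun z : E × E =>
      fderiv ℝ f z.1 z.2 * g (Real.cos θ • z.1 + -Real.sin θ • z.2) :=
    (hf.continuous_fderiv_apply one_ne_zero).mul (hg.continuous.comp (by fun_prop))
  have hnorm : Integrable (fun z : E × E =>
      ‖fderiv ℝ g (Real.cos θ • z.1 + -Real.sin θ • z.2)‖) (γ.prod γ) :=
    .of_bound (by fun_prop) (L : ℝ)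
      (.of_forall fun z => by simpa using norm_fderiv_le_of_lipschitz ℝ hL)
  calc |∫ z, fderiv ℝ f (Real.cos θ • z.1 + Real.sin θ • z.2)
        (-Real.sin θ • z.1 + Real.cos θ • z.2) * g z.1 ∂γ.prod γ|
      = |∫ z, fderiv ℝ f z.1 z.2 * g (Real.cos θ • z.1 + -Real.sin θ • z.2) ∂γ.prod γ| := by
        rw [← integral_comp_rotation_stdGaussian hcont θ]
        simp only [unrotate_fst, γ]
    _ = |∫ u, ∫ w, fderiv ℝ f u w * g (Real.cos θ • u + -Real.sin θ • w) ∂γ ∂γ| := by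
        rw [integral_prod]
        exact (memLp_fderiv_apply hf hK hfst.1 hsnd).integrable_mul
          (memLp_comp_of_lipschitzWith hL ((hfst.const_smul _).add (hsnd.const_smul _)))
    _ ≤ ∫ u, K * (|Real.sin θ| *
          ∫ w, ‖fderiv ℝ g (Real.cos θ • u + -Real.sin θ • w)‖ ∂γ) ∂γ := by
        rw [← Real.norm_eq_abs]
        refine norm_integral_le_of_norm_le ((hnorm.integral_prod_left.const_mul _).const_mul _)
          (.of_forall fun u => ?_)
        refine (abs_integral_strongDual_mul_comp_add_smul_stdGaussian_le _ hg hL _ _).trans ?_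
        rw [abs_neg]
        gcongr
        exact norm_fderiv_le_of_lipschitz ℝ hK
    _ = K * |Real.sin θ| * ∫ x, ‖fderiv ℝ g x‖ ∂γ := by
        rw [← integral_comp_cos_sub_sin_stdGaussian hdg.norm θ, integral_prod _ hnorm,
          integral_const_mul, integral_const_mul, mul_assoc]

theorem covariance_stdGaussian_le (hf : ContDiff ℝ 1 f) (hK : LipschitzWith K f)
    (hg : ContDiff ℝ 1 g) (hL : LipschitzWith L g) :
    cov[f, g; stdGaussian E] ≤ K * ∫ x, ‖fderiv ℝ g x‖ ∂stdGaussian E := by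
  set γ := stdGaussian E
  have hfst : MemLp (Prod.fst : E × E → E) 2 (γ.prod γ) := IsGaussian.memLp_two_id.comp_fst γ
  have hsnd : MemLp (Prod.snd : E × E → E) 2 (γ.prod γ) := IsGaussian.memLp_two_id.comp_snd γ
  have hf₂ : MemLp f 2 γ := memLp_comp_of_lipschitzWith hK IsGaussian.memLp_two_id
  have hg₂ : MemLp g 2 γ := memLp_comp_of_lipschitzWith hL IsGaussian.memLp_two_id
  set D := K * ∫ x, ‖fderiv ℝ g x‖ ∂γ
  set Φ : ℝ → ℝ := fun θ =>
    ∫ z, f (Real.cos θ • z.1 + Real.sin θ • z.2) * g z.1 ∂γ.prod γ with hΦ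
  have hderiv (θ : ℝ) := (hasDerivAt_integral_comp_cos_add_sin_mul hf hK hfst hsnd
    (hg₂.comp_fst γ) θ).sub ((Real.hasDerivAt_cos θ).const_mul D)
  have hmono : MonotoneOn (fun θ => Φ θ - D * Real.cos θ) (Set.Icc 0 (Real.pi / 2)) := by
    refine monotoneOn_of_hasDerivWithinAt_nonneg (convex_Icc _ _)
      (fun θ _ => (hderiv θ).continuousAt.continuousWithinAt)
      (fun θ _ => (hderiv θ).hasDerivWithinAt) fun θ hθ => ?_
    rw [interior_Icc] at hθ
    have hsin : 0 ≤ Real.sin θ :=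
      Real.sin_nonneg_of_nonneg_of_le_pi hθ.1.le (by linarith [hθ.2, Real.pi_pos])
    have h := (abs_le.1 (abs_integral_fderiv_rotation_mul_le hf hK hg hL θ)).1
    rw [abs_of_nonneg hsin] at h
    simp only [D]
    linarith
  have hends := hmono (Set.left_mem_Icc.2 (by positivity)) (Set.right_mem_Icc.2 (by positivity))
    (by positivity)
  have hΦ₀ : Φ 0 = ∫ x, f x * g x ∂γ := by
    simp [hΦ, integral_fun_fst (fun x => f x * g x)]
  have hΦ₁ : Φ (Real.pi / 2) = (∫ x, f x ∂γ) * ∫ x, g x ∂γ := by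
    simp [hΦ, ← integral_prod_mul, mul_comm (f _), mul_comm (∫ x, f x ∂γ)]
  rw [covariance_eq_sub hf₂ hg₂]
  simp only [hΦ₀, hΦ₁, Real.cos_zero, Real.cos_pi_div_two] at hends
  simp only [Pi.mul_apply]
  linarith

end Covariance

section Mollification

variable {E : Type*} [NormedAddCommGroup E] [NormedSpace ℝ E] [FiniteDimensional ℝ E] {K : ℝ≥0}
  {f : E → ℝ}

theorem exists_contDiff_lipschitzWith_abs_sub_le (hK : LipschitzWith K f) {ε : ℝ} (hε : 0 < ε) :
    ∃ g : E → ℝ, ContDiff ℝ 1 g ∧ LipschitzWith K g ∧ ∀ x, |g x - f x| ≤ ε := by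
  borelize E
  set δ := ε / (K + 1)
  have hδ : 0 < δ := by positivity
  let φ : ContDiffBump (0 : E) := ⟨δ / 2, δ, half_pos hδ, half_lt_self hδ⟩
  set ψ : E → ℝ := φ.normed Measure.addHaar
  have hint (x : E) : Integrable (fun t => ψ t * f (x - t)) Measure.addHaar :=
    (φ.continuous_normed.mul (hK.continuous.comp (by fun_prop))).integrable_of_hasCompactSupport
      φ.hasCompactSupport_normed.mul_right
  refine ⟨fun x => ∫ t, ψ t * f (x - t) ∂Measure.addHaar, ?_, ?_, fun x => ?_⟩
  · exact φ.hasCompactSupport_normed.contDiff_convolution_left (.lsmul ℝ ℝ) φ.contDiff_normed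
      hK.continuous.locallyIntegrable
  · refine LipschitzWith.of_dist_le_mul fun x y => ?_
    rw [Real.dist_eq, ← integral_sub (hint x) (hint y)]
    have hle : ∀ t, ‖ψ t * f (x - t) - ψ t * f (y - t)‖ ≤ ψ t * (K * dist x y) := fun t => by
      rw [← mul_sub, norm_mul, Real.norm_of_nonneg (φ.nonneg_normed t)]
      gcongr
      · exact φ.nonneg_normed t
      · simpa [Real.dist_eq] using hK.dist_le_mul (x - t) (y - t)
    simpa [integral_mul_const, ψ, φ.integral_normed] using
      norm_integral_le_of_norm_le (φ.integrable_normed.mul_const _) (.of_forall hle)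
  · refine φ.dist_normed_convolution_le hK.continuous.aestronglyMeasurable fun y hy => ?_
    calc dist (f y) (f x) ≤ K * dist y x := hK.dist_le_mul y x
      _ ≤ (K + 1) * δ := by gcongr; exacts [by simp, (Metric.mem_ball.1 hy).le]
      _ = ε := by simp only [δ]; field_simp

theorem exists_seq_contDiff_lipschitzWith_tendsto (hK : LipschitzWith K f) :
    ∃ F : ℕ → E → ℝ, (∀ n, ContDiff ℝ 1 (F n)) ∧ (∀ n, LipschitzWith K (F n)) ∧
      (∀ n, ∃ C, ∀ x, |F n x| ≤ C) ∧ (∀ n x, |F n x| ≤ |f x| + 1) ∧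
      ∀ x, Filter.Tendsto (fun n => F n x) Filter.atTop (𝓝 (f x)) := by
  set T : ℕ → E → ℝ := fun n x => max (-n) (min (f x) n)
  have hT (n : ℕ) : LipschitzWith K (T n) := (hK.min_const _).const_max _
  have hTn (n : ℕ) (x) : |T n x| ≤ n :=
    abs_le.2 ⟨le_max_left _ _, max_le (by simp) (min_le_right _ _)⟩
  have hTf (n : ℕ) (x) : |T n x| ≤ |f x| := by
    have hn : (0 : ℝ) ≤ n := n.cast_nonneg
    grind
  have hTeq (x) : ∀ᶠ n in Filter.atTop, T n x = f x := by
    filter_upwards [Filter.eventually_ge_atTop ⌈|f x|⌉₊] with n hn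
    have := abs_le.1 (Nat.ceil_le.1 hn)
    simp only [T, min_eq_left this.2, max_eq_right this.1]
  choose F hF hFK hFT using fun n : ℕ => exists_contDiff_lipschitzWith_abs_sub_le (hT n)
    (Nat.one_div_pos_of_nat (α := ℝ) (n := n))
  have hFle (n : ℕ) (x) : |F n x| ≤ |T n x| + 1 := by
    have h₁ : 1 / ((n : ℝ) + 1) ≤ 1 := div_le_self zero_le_one (by simp)
    have h₂ := abs_sub_abs_le_abs_sub (F n x) (T n x)
    linarith [hFT n x]
  refine ⟨F, hF, hFK, fun n => ⟨n + 1, fun x => by linarith [hFle n x, hTn n x]⟩,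
    fun n x => by linarith [hFle n x, hTf n x], fun x => ?_⟩
  rw [tendsto_iff_dist_tendsto_zero]
  refine squeeze_zero' (.of_forall fun _ => dist_nonneg) ?_ tendsto_one_div_add_atTop_nhds_zero_nat
  filter_upwards [hTeq x] with n hn
  simpa only [Real.dist_eq, hn] using hFT n x

end Mollification

section Concentration

variable {E : Type*} [NormedAddCommGroup E] {K : ℝ≥0} {f : E → ℝ} {C t : ℝ}

section NormedSpace

variable [NormedSpace ℝ E]

theorem norm_fderiv_exp_mul_le (hf : ContDiff ℝ 1 f) (hK : LipschitzWith K f) (ht : 0 ≤ t)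
    (x : E) : ‖fderiv ℝ (fun x => Real.exp (t * f x)) x‖ ≤ t * K * Real.exp (t * f x) := by
  have hfx : DifferentiableAt ℝ f x := hf.differentiable one_ne_zero x
  rw [fderiv_exp (hfx.const_mul t), fderiv_const_mul hfx, norm_smul, norm_smul,
    Real.norm_of_nonneg ht, Real.norm_of_nonneg (Real.exp_pos _).le, mul_comm]
  gcongr
  exact norm_fderiv_le_of_lipschitz ℝ hK

theorem lipschitzWith_exp_mul (hf : ContDiff ℝ 1 f) (hK : LipschitzWith K f)
    (hC : ∀ x, |f x| ≤ C) (ht : 0 ≤ t) :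
    LipschitzWith (t * K * Real.exp (t * C)).toNNReal fun x => Real.exp (t * f x) := by
  refine lipschitzWith_of_nnnorm_fderiv_le (𝕜 := ℝ)
    (((hf.const_smul t).exp).differentiable one_ne_zero) fun x => ?_
  rw [← NNReal.coe_le_coe, coe_nnnorm, Real.coe_toNNReal _ (by positivity)]
  refine (norm_fderiv_exp_mul_le hf hK ht x).trans ?_
  gcongr
  exact (abs_le.1 (hC x)).2

end NormedSpace

variable [InnerProductSpace ℝ E] [FiniteDimensional ℝ E] [MeasurableSpace E] [BorelSpace E]

theorem memLp_two_stdGaussian_of_lipschitzWith (hK : LipschitzWith K f) :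
    MemLp f 2 (stdGaussian E) :=
  memLp_comp_of_lipschitzWith hK IsGaussian.memLp_two_id

theorem integral_mul_exp_mul_stdGaussian_le (hf : ContDiff ℝ 1 f) (hK : LipschitzWith K f)
    (hC : ∀ x, |f x| ≤ C) (ht : 0 ≤ t) :
    ∫ x, f x * Real.exp (t * f x) ∂stdGaussian E ≤
      (∫ x, f x ∂stdGaussian E + K ^ 2 * t) * mgf f (stdGaussian E) t := by
  have hg : ContDiff ℝ 1 fun x => Real.exp (t * f x) := (hf.const_smul t).exp
  have hL := lipschitzWith_exp_mul hf hK hC ht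
  have hf₂ : MemLp f 2 (stdGaussian E) := memLp_two_stdGaussian_of_lipschitzWith hK
  have hg₂ : MemLp (fun x => Real.exp (t * f x)) 2 (stdGaussian E) :=
    memLp_two_stdGaussian_of_lipschitzWith hL
  have hcov := covariance_stdGaussian_le hf hK hg hL
  have hgrad : ∫ x, ‖fderiv ℝ (fun x => Real.exp (t * f x)) x‖ ∂stdGaussian E ≤
      t * K * mgf f (stdGaussian E) t := by
    rw [mgf, ← integral_const_mul]
    exact integral_mono_of_nonneg (.of_forall fun _ => norm_nonneg _)
      ((hg₂.integrable one_le_two).const_mul _)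
      (.of_forall fun x => norm_fderiv_exp_mul_le hf hK ht x)
  calc ∫ x, f x * Real.exp (t * f x) ∂stdGaussian E
      = cov[f, fun x => Real.exp (t * f x); stdGaussian E] +
          (∫ x, f x ∂stdGaussian E) * mgf f (stdGaussian E) t := by
        rw [covariance_eq_sub hf₂ hg₂, mgf, sub_add_cancel]
        rfl
    _ ≤ K * (t * K * mgf f (stdGaussian E) t) +
          (∫ x, f x ∂stdGaussian E) * mgf f (stdGaussian E) t := by
        gcongr
        exact hcov.trans (mul_le_mul_of_nonneg_left hgrad K.coe_nonneg)
    _ = (∫ x, f x ∂stdGaussian E + K ^ 2 * t) * mgf f (stdGaussian E) t := by ring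

theorem integrable_exp_mul_stdGaussian_of_abs_le (hf : Continuous f) (hC : ∀ x, |f x| ≤ C)
    (t : ℝ) : Integrable (fun x => Real.exp (t * f x)) (stdGaussian E) :=
  integrable_exp_mul_of_mem_Icc hf.aemeasurable (.of_forall fun x => abs_le.1 (hC x))

theorem cgf_stdGaussian_le (hf : ContDiff ℝ 1 f) (hK : LipschitzWith K f)
    (hC : ∀ x, |f x| ≤ C) (ht : 0 ≤ t) :
    cgf f (stdGaussian E) t ≤ t * ∫ x, f x ∂stdGaussian E + K ^ 2 * t ^ 2 / 2 := by
  have hexp := integrable_exp_mul_stdGaussian_of_abs_le hf.continuous hC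
  have hint (s) : s ∈ interior (integrableExpSet f (stdGaussian E)) := by
    simp [integrableExpSet, hexp]
  set ψ : ℝ → ℝ := fun s =>
    s * ∫ x, f x ∂stdGaussian E + K ^ 2 * s ^ 2 / 2 - cgf f (stdGaussian E) s
  have hψ (s) : HasDerivAt ψ (∫ x, f x ∂stdGaussian E + K ^ 2 * s -
      deriv (cgf f (stdGaussian E)) s) s := by
    have hcgf := (analyticAt_cgf (hint s)).differentiableAt.hasDerivAt
    exact ((((hasDerivAt_id s).mul_const (∫ x, f x ∂stdGaussian E)).add
      (((hasDerivAt_pow 2 s).const_mul ((K : ℝ) ^ 2)).div_const 2)).sub hcgf).congr_deriv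
      (by simp; ring)
  have hmono : MonotoneOn ψ (Set.Ici 0) := by
    refine monotoneOn_of_hasDerivWithinAt_nonneg (convex_Ici 0)
      (fun s _ => (hψ s).continuousAt.continuousWithinAt)
      (fun s _ => (hψ s).hasDerivWithinAt) fun s hs => ?_
    rw [deriv_cgf (hint s), sub_nonneg, div_le_iff₀ (mgf_pos (hexp s))]
    exact integral_mul_exp_mul_stdGaussian_le hf hK hC (interior_subset hs)
  have h := hmono Set.self_mem_Ici ht ht
  simp only [ψ, cgf_zero] at h
  linarith

theorem lintegral_exp_mul_stdGaussian_le (hf : ContDiff ℝ 1 f) (hK : LipschitzWith K f)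
    (hC : ∀ x, |f x| ≤ C) (ht : 0 ≤ t) :
    ∫⁻ x, .ofReal (Real.exp (t * f x)) ∂stdGaussian E ≤
      .ofReal (Real.exp (t * ∫ x, f x ∂stdGaussian E + K ^ 2 * t ^ 2 / 2)) := by
  have hint := integrable_exp_mul_stdGaussian_of_abs_le hf.continuous hC t
  rw [← ofReal_integral_eq_lintegral_ofReal hint (.of_forall fun _ => (Real.exp_pos _).le)]
  gcongr
  rw [← mgf, ← exp_cgf hint, Real.exp_le_exp]
  exact cgf_stdGaussian_le hf hK hC ht

theorem lintegral_exp_mul_stdGaussian_le_of_lipschitzWith (hK : LipschitzWith K f) (ht : 0 ≤ t) :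
    ∫⁻ x, .ofReal (Real.exp (t * f x)) ∂stdGaussian E ≤
      .ofReal (Real.exp (t * ∫ x, f x ∂stdGaussian E + K ^ 2 * t ^ 2 / 2)) := by
  obtain ⟨F, hF, hFK, hFC, hFf, hlim⟩ := exists_seq_contDiff_lipschitzWith_tendsto hK
  have hf₂ : MemLp f 2 (stdGaussian E) := memLp_two_stdGaussian_of_lipschitzWith hK
  have hmean : Filter.Tendsto (fun n => ∫ x, F n x ∂stdGaussian E) Filter.atTop
      (𝓝 (∫ x, f x ∂stdGaussian E)) :=
    tendsto_integral_of_dominated_convergence (fun x => |f x| + 1)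
      (fun n => (hF n).continuous.aestronglyMeasurable)
      ((hf₂.integrable one_le_two).abs.add (integrable_const _))
      (fun n => .of_forall fun x => hFf n x) (.of_forall hlim)
  have hbound : Filter.Tendsto (fun n => ENNReal.ofReal (Real.exp
      (t * ∫ x, F n x ∂stdGaussian E + K ^ 2 * t ^ 2 / 2))) Filter.atTop
      (𝓝 (.ofReal (Real.exp (t * ∫ x, f x ∂stdGaussian E + K ^ 2 * t ^ 2 / 2)))) :=
    ENNReal.tendsto_ofReal (Real.continuous_exp.continuousAt.tendsto.comp
      ((hmean.const_mul t).add_const _))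
  calc ∫⁻ x, .ofReal (Real.exp (t * f x)) ∂stdGaussian E
      = ∫⁻ x, Filter.liminf (fun n => .ofReal (Real.exp (t * F n x))) Filter.atTop
          ∂stdGaussian E := by
        refine lintegral_congr fun x => (Filter.Tendsto.liminf_eq ?_).symm
        exact ENNReal.tendsto_ofReal
          (Real.continuous_exp.continuousAt.tendsto.comp ((hlim x).const_mul t))
    _ ≤ Filter.liminf (fun n => ∫⁻ x, .ofReal (Real.exp (t * F n x)) ∂stdGaussian E)
          Filter.atTop :=
        lintegral_liminf_le fun n => by
          have := (hF n).continuous.measurable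
          fun_prop
    _ ≤ _ := by
        rw [← hbound.liminf_eq]
        refine Filter.liminf_le_liminf (.of_forall fun n => ?_)
        obtain ⟨C, hC⟩ := hFC n
        exact lintegral_exp_mul_stdGaussian_le (hF n) (hFK n) hC ht

theorem lintegral_exp_mul_sub_integral_stdGaussian_le (hK : LipschitzWith K f) (t : ℝ) :
    ∫⁻ x, .ofReal (Real.exp (t * (f x - ∫ y, f y ∂stdGaussian E))) ∂stdGaussian E ≤
      .ofReal (Real.exp (K ^ 2 * t ^ 2 / 2)) := by
  wlog ht : 0 ≤ t generalizing f t
  · have h := this hK.neg (-t) (by linarith)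
    simpa [integral_neg, mul_sub, neg_add_eq_sub] using h
  have hcenter : LipschitzWith K fun x => f x - ∫ y, f y ∂stdGaussian E := by
    simpa using hK.sub (.const _)
  have hf₂ : MemLp f 2 (stdGaussian E) := memLp_two_stdGaussian_of_lipschitzWith hK
  have hmean : ∫ x, (f x - ∫ y, f y ∂stdGaussian E) ∂stdGaussian E = 0 := by
    simp [integral_sub (hf₂.integrable one_le_two) (integrable_const _)]
  simpa only [hmean, mul_zero, zero_add] using
    lintegral_exp_mul_stdGaussian_le_of_lipschitzWith hcenter ht

theorem hasSubgaussianMGF_stdGaussian (hK : LipschitzWith K f) :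
    HasSubgaussianMGF (fun x => f x - ∫ y, f y ∂stdGaussian E) (K ^ 2) (stdGaussian E) := by
  have hint (t : ℝ) : Integrable
      (fun x => Real.exp (t * (f x - ∫ y, f y ∂stdGaussian E))) (stdGaussian E) := by
    have := hK.continuous
    rw [← lintegral_ofReal_ne_top_iff_integrable (by fun_prop)
      (.of_forall fun _ => (Real.exp_pos _).le)]
    exact ((lintegral_exp_mul_sub_integral_stdGaussian_le hK t).trans_lt ENNReal.ofReal_lt_top).ne
  refine ⟨hint, fun t => ?_⟩
  rw [← ENNReal.ofReal_le_ofReal_iff (Real.exp_pos _).le, mgf,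
    ofReal_integral_eq_lintegral_ofReal (hint t) (.of_forall fun _ => (Real.exp_pos _).le)]
  exact lintegral_exp_mul_sub_integral_stdGaussian_le hK t

end Concentration

section SubgaussianTails

variable {Ω : Type*} [MeasurableSpace Ω] {μ : Measure Ω} {X : Ω → ℝ} {c : ℝ≥0}

theorem measureReal_le_abs_of_hasSubgaussianMGF [IsFiniteMeasure μ] (hX : HasSubgaussianMGF X c μ)
    {s : ℝ} (hs : 0 ≤ s) : μ.real {ω | s ≤ |X ω|} ≤ 2 * Real.exp (-s ^ 2 / (2 * c)) := by
  calc μ.real {ω | s ≤ |X ω|}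
      = μ.real ({ω | s ≤ X ω} ∪ {ω | s ≤ (-X) ω}) := by
        simp only [le_abs, Set.ofPred_or, Pi.neg_apply]
    _ ≤ μ.real {ω | s ≤ X ω} + μ.real {ω | s ≤ (-X) ω} := measureReal_union_le _ _
    _ ≤ 2 * Real.exp (-s ^ 2 / (2 * c)) := by
        linarith [hX.measure_ge_le hs, hX.neg.measure_ge_le hs]

theorem integral_abs_le_of_hasSubgaussianMGF (hX : HasSubgaussianMGF X 1 μ) :
    ∫ ω, |X ω| ∂μ ≤ 2 * Real.exp (1 / 2) := by
  have hexp (x : ℝ) : |x| ≤ Real.exp (1 * x) + Real.exp (-1 * x) := by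
    have h₁ := Real.add_one_le_exp (1 * x)
    have h₂ := Real.add_one_le_exp (-1 * x)
    have h₃ := Real.exp_pos (1 * x)
    have h₄ := Real.exp_pos (-1 * x)
    rcases abs_cases x with h | h <;> linarith
  calc ∫ ω, |X ω| ∂μ
      ≤ ∫ ω, (Real.exp (1 * X ω) + Real.exp (-1 * X ω)) ∂μ :=
        integral_mono hX.integrable.abs
          ((hX.integrable_exp_mul 1).add (hX.integrable_exp_mul (-1))) fun ω => hexp (X ω)
    _ = mgf X μ 1 + mgf X μ (-1) :=
        integral_add (hX.integrable_exp_mul 1) (hX.integrable_exp_mul (-1))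
    _ ≤ 2 * Real.exp (1 / 2) := by
        have h₁ := hX.mgf_le 1
        have h₂ := hX.mgf_le (-1)
        norm_num at h₁ h₂ ⊢
        linarith

end SubgaussianTails

section LogSumExp

variable {ι : Type*} [Fintype ι]

/-- The log-partition function `log ∑ᵢ exp vᵢ`, a smooth approximation of `maxᵢ vᵢ`. -/
noncomputable def logSumExp (v : ι → ℝ) : ℝ := Real.log (∑ i, Real.exp (v i))

/-- The Gibbs weights `exp vᵢ / ∑ⱼ exp vⱼ`, the gradient of `logSumExp`. -/
noncomputable def softmax (v : ι → ℝ) (i : ι) : ℝ := Real.exp (v i) / ∑ j, Real.exp (v j)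

theorem softmax_nonneg (v : ι → ℝ) (i : ι) : 0 ≤ softmax v i := by
  unfold softmax; positivity

variable [Nonempty ι]

theorem sum_exp_pos (v : ι → ℝ) : 0 < ∑ i, Real.exp (v i) :=
  Finset.sum_pos (fun _ _ => Real.exp_pos _) Finset.univ_nonempty

theorem sum_softmax (v : ι → ℝ) : ∑ i, softmax v i = 1 := by
  simp only [softmax, ← Finset.sum_div, div_self (sum_exp_pos v).ne']

theorem softmax_le_one (v : ι → ℝ) (i : ι) : softmax v i ≤ 1 :=
  (Finset.single_le_sum (fun j _ => softmax_nonneg v j) (Finset.mem_univ i)).trans_eq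
    (sum_softmax v)

theorem abs_sum_softmax_mul_le (v w : ι → ℝ) : |∑ i, softmax v i * w i| ≤ ‖w‖ := by
  calc |∑ i, softmax v i * w i| ≤ ∑ i, |softmax v i * w i| := Finset.abs_sum_le_sum_abs _ _
    _ ≤ ∑ i, softmax v i * ‖w‖ := by
        gcongr with i
        rw [abs_mul, abs_of_nonneg (softmax_nonneg v i)]
        exact mul_le_mul_of_nonneg_left (norm_le_pi_norm w i) (softmax_nonneg v i)
    _ = ‖w‖ := by rw [← Finset.sum_mul, sum_softmax, one_mul]

theorem contDiff_logSumExp : ContDiff ℝ 1 (logSumExp : (ι → ℝ) → ℝ) :=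
  ContDiff.log (by fun_prop) fun v => (sum_exp_pos v).ne'

theorem contDiff_softmax (i : ι) : ContDiff ℝ 1 fun v : ι → ℝ => softmax v i :=
  ContDiff.div (by fun_prop) (by fun_prop) fun v => (sum_exp_pos v).ne'

theorem fderiv_logSumExp_apply (v w : ι → ℝ) :
    fderiv ℝ logSumExp v w = ∑ i, softmax v i * w i := by
  have hsum : HasFDerivAt (fun v : ι → ℝ => ∑ i, Real.exp (v i))
      (∑ i, Real.exp (v i) • ContinuousLinearMap.proj (R := ℝ) (φ := fun _ : ι => ℝ) i) v :=
    HasFDerivAt.fun_sum fun i _ => (hasFDerivAt_apply i v).exp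
  have hlog : HasFDerivAt logSumExp _ v := hsum.log (sum_exp_pos v).ne'
  rw [hlog.fderiv]
  simp [softmax, Finset.mul_sum, div_eq_inv_mul, mul_assoc]

theorem softmax_eq_exp_sub (v : ι → ℝ) (i : ι) : softmax v i = Real.exp (v i - logSumExp v) := by
  rw [Real.exp_sub, logSumExp, Real.exp_log (sum_exp_pos v), softmax]

theorem fderiv_softmax_apply (v w : ι → ℝ) (i : ι) :
    fderiv ℝ (fun v => softmax v i) v w = softmax v i * (w i - ∑ j, softmax v j * w j) := by
  simp only [softmax_eq_exp_sub _ i]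
  rw [((hasFDerivAt_apply i v).fun_sub
    (contDiff_logSumExp.differentiable one_ne_zero v).hasFDerivAt).exp.fderiv]
  simp [fderiv_logSumExp_apply]

theorem lipschitzWith_logSumExp : LipschitzWith 1 (logSumExp : (ι → ℝ) → ℝ) := by
  refine lipschitzWith_of_nnnorm_fderiv_le (𝕜 := ℝ)
    (contDiff_logSumExp.differentiable one_ne_zero) fun v => ?_
  refine ContinuousLinearMap.opNorm_le_bound _ zero_le_one fun w => ?_
  simpa [fderiv_logSumExp_apply] using abs_sum_softmax_mul_le v w

theorem lipschitzWith_softmax (i : ι) : LipschitzWith 2 fun v : ι → ℝ => softmax v i := by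
  refine lipschitzWith_of_nnnorm_fderiv_le (𝕜 := ℝ)
    ((contDiff_softmax i).differentiable one_ne_zero) fun v => ?_
  refine ContinuousLinearMap.opNorm_le_bound _ zero_le_two fun w => ?_
  rw [fderiv_softmax_apply, norm_mul, Real.norm_of_nonneg (softmax_nonneg v i)]
  calc softmax v i * ‖w i - ∑ j, softmax v j * w j‖ ≤ 1 * (‖w‖ + ‖w‖) := by
        gcongr
        · exact softmax_le_one v i
        · exact (norm_sub_le _ _).trans
            (add_le_add (norm_le_pi_norm w i) (abs_sum_softmax_mul_le v w))
    _ = 2 * ‖w‖ := by ring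

theorem lipschitzWith_iSup : LipschitzWith 1 fun v : ι → ℝ => ⨆ i, v i :=
  LipschitzWith.of_le_add fun v w => ciSup_le fun i => by
    have hi : v i - w i ≤ dist v w := (le_abs_self _).trans (dist_le_pi_dist v w i)
    linarith [le_ciSup (Set.finite_range w).bddAbove i]

theorem iSup_le_logSumExp (v : ι → ℝ) : ⨆ i, v i ≤ logSumExp v :=
  ciSup_le fun i => (Real.le_log_iff_exp_le (sum_exp_pos v)).2 <|
    Finset.single_le_sum (f := fun i => Real.exp (v i)) (fun _ _ => (Real.exp_pos _).le)
      (Finset.mem_univ i)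

theorem logSumExp_le_iSup_add_log_card (v : ι → ℝ) :
    logSumExp v ≤ (⨆ i, v i) + Real.log (Fintype.card ι) := by
  have hcard : (0 : ℝ) < Fintype.card ι := by exact_mod_cast Fintype.card_pos
  rw [logSumExp, Real.log_le_iff_le_exp (sum_exp_pos v), Real.exp_add, Real.exp_log hcard,
    mul_comm, ← nsmul_eq_mul]
  exact Finset.sum_le_card_nsmul _ _ _ fun i _ =>
    Real.exp_le_exp.2 (le_ciSup (Set.finite_range v).bddAbove i)

end LogSumExp

section InnerPi

variable {ι E : Type*} [NormedAddCommGroup E] [InnerProductSpace ℝ E]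

/-- The linear map `x ↦ (⟨aᵢ, x⟩)ᵢ`; under the standard Gaussian measure it is the centred Gaussian
process with increments `‖aᵢ - aⱼ‖`. -/
noncomputable def innerPi (a : ι → E) : E →L[ℝ] ι → ℝ :=
  ContinuousLinearMap.pi fun i => innerSL ℝ (a i)

theorem iSup_smul_add_innerPi_smul (m : ι → ℝ) (a : ι → E) {r : ℝ} (hr : 0 ≤ r) (x : E) :
    ⨆ i, (r • m + innerPi (r • a) x) i = r * ⨆ i, (m + innerPi a x) i := by
  simp [Real.mul_iSup_of_nonneg hr, innerPi, mul_add]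

variable [FiniteDimensional ℝ E] [MeasurableSpace E] [BorelSpace E] [Fintype ι]

theorem memLp_innerPi (a : ι → E) : MemLp (innerPi a) 2 (stdGaussian E) :=
  IsGaussian.memLp_two_id.continuousLinearMap_comp (innerPi a)

theorem integrable_comp_add_innerPi {f : (ι → ℝ) → ℝ} {K : ℝ≥0} (hK : LipschitzWith K f)
    (m : ι → ℝ) (a : ι → E) : Integrable (fun x => f (m + innerPi a x)) (stdGaussian E) :=
  (memLp_comp_of_lipschitzWith hK ((memLp_const m).add (memLp_innerPi a))).integrable one_le_two

end InnerPi

section SudakovFernique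

variable {ι : Type*} [Fintype ι]

/-- `∑ᵢⱼ pᵢ pⱼ ‖aᵢ - aⱼ‖²` for the Gibbs weights `p` of `v`: the term through which the increments
of a Gaussian process enter the derivative along Gaussian interpolation. -/
noncomputable def gibbsIncrement {E : Type*} [NormedAddCommGroup E] (a : ι → E) (v : ι → ℝ) : ℝ :=
  ∑ i, ∑ j, softmax v i * softmax v j * ‖a i - a j‖ ^ 2

theorem gibbsIncrement_mono {E F : Type*} [NormedAddCommGroup E] [NormedAddCommGroup F]
    {a : ι → E} {b : ι → F} (h : ∀ i j, ‖a i - a j‖ ≤ ‖b i - b j‖) (v : ι → ℝ) :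
    gibbsIncrement a v ≤ gibbsIncrement b v := by
  unfold gibbsIncrement
  gcongr with i _ j _
  · exact mul_nonneg (softmax_nonneg v i) (softmax_nonneg v j)
  · exact h i j

variable [Nonempty ι]

theorem continuous_gibbsIncrement {E : Type*} [NormedAddCommGroup E] (a : ι → E) :
    Continuous (gibbsIncrement a) := by
  have (i : ι) : Continuous fun v : ι → ℝ => softmax v i := (contDiff_softmax i).continuous
  unfold gibbsIncrement
  fun_prop

theorem abs_gibbsIncrement_le {E : Type*} [NormedAddCommGroup E] (a : ι → E) (v : ι → ℝ) :
    |gibbsIncrement a v| ≤ ∑ i, ∑ j, ‖a i - a j‖ ^ 2 := by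
  have hnonneg : 0 ≤ gibbsIncrement a v := Finset.sum_nonneg fun i _ => Finset.sum_nonneg fun j _ =>
    mul_nonneg (mul_nonneg (softmax_nonneg v i) (softmax_nonneg v j)) (sq_nonneg _)
  rw [abs_of_nonneg hnonneg]
  refine Finset.sum_le_sum fun i _ => Finset.sum_le_sum fun j _ => ?_
  exact mul_le_of_le_one_left (sq_nonneg _)
    (mul_le_one₀ (softmax_le_one v i) (softmax_nonneg v j) (softmax_le_one v j))

theorem integrable_gibbsIncrement_comp {E Ω : Type*} [NormedAddCommGroup E] [MeasurableSpace Ω]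
    {μ : Measure Ω} [IsFiniteMeasure μ] (a : ι → E) {V : Ω → ι → ℝ}
    (hV : AEStronglyMeasurable V μ) :
    Integrable (fun ω => gibbsIncrement a (V ω)) μ :=
  .of_bound ((continuous_gibbsIncrement a).comp_aestronglyMeasurable hV)
    (∑ i, ∑ j, ‖a i - a j‖ ^ 2) (.of_forall fun ω => abs_gibbsIncrement_le a (V ω))

variable {E : Type*} [NormedAddCommGroup E] [InnerProductSpace ℝ E]

theorem sum_softmax_mul_fderiv (a : ι → E) (v : ι → ℝ) :
    ∑ i, softmax v i * (⟪a i, a i⟫ - ∑ j, softmax v j * ⟪a j, a i⟫) = gibbsIncrement a v / 2 := by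
  have hswap : ∑ i, ∑ j, softmax v i * softmax v j * ‖a j‖ ^ 2 =
      ∑ i, softmax v i * ‖a i‖ ^ 2 := by
    rw [Finset.sum_comm]
    simp only [← Finset.sum_mul, sum_softmax, one_mul]
  have hdiag : ∑ i, ∑ j, softmax v i * softmax v j * ‖a i‖ ^ 2 =
      ∑ i, softmax v i * ‖a i‖ ^ 2 := by
    simp only [← Finset.sum_mul, ← Finset.mul_sum, sum_softmax, mul_one]
  have hexpand : gibbsIncrement a v = ∑ i, ∑ j, softmax v i * softmax v j * ‖a i‖ ^ 2 -
      2 * ∑ i, softmax v i * ∑ j, softmax v j * ⟪a j, a i⟫ +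
      ∑ i, ∑ j, softmax v i * softmax v j * ‖a j‖ ^ 2 := by
    simp only [gibbsIncrement, Finset.mul_sum, ← Finset.sum_sub_distrib, ← Finset.sum_add_distrib,
      norm_sub_sq_real]
    refine Finset.sum_congr rfl fun i _ => Finset.sum_congr rfl fun j _ => ?_
    rw [real_inner_comm]
    ring
  rw [hexpand, hswap, hdiag]
  simp only [mul_sub, Finset.sum_sub_distrib, real_inner_self_eq_norm_sq]
  ring

variable [FiniteDimensional ℝ E] [MeasurableSpace E] [BorelSpace E]

theorem integral_softmax_mul_inner_stdGaussian (a : ι → E) (m : ι → ℝ) (c : ℝ) (i : ι) :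
    ∫ x, softmax (m + c • innerPi a x) i * ⟪a i, x⟫ ∂stdGaussian E =
      ∫ x, fderiv ℝ (fun v => softmax v i) (m + c • innerPi a x) (c • innerPi a (a i))
        ∂stdGaussian E := by
  have hlip := (lipschitzWith_softmax i).comp
    ((LipschitzWith.const m).add (c • innerPi a).lipschitz)
  have hdiff : ContDiff ℝ 1 fun x => softmax (m + c • innerPi a x) i :=
    (contDiff_softmax i).comp (by fun_prop)
  rw [integral_mul_inner_stdGaussian hdiff hlip]
  congr with x
  have hcomp : HasFDerivAt (fun x => softmax (m + c • innerPi a x) i) _ x :=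
    ((contDiff_softmax i).differentiable one_ne_zero _).hasFDerivAt.comp x
      (((innerPi a).hasFDerivAt.const_smul c).const_add m)
  rw [hcomp.fderiv]
  rfl

theorem integral_fderiv_logSumExp_innerPi (a : ι → E) (m : ι → ℝ) (c : ℝ) :
    ∫ x, fderiv ℝ logSumExp (m + c • innerPi a x) (innerPi a x) ∂stdGaussian E =
      c / 2 * ∫ x, gibbsIncrement a (m + c • innerPi a x) ∂stdGaussian E := by
  have haff : Continuous fun x => m + c • innerPi a x := by fun_prop
  have hsoft (i : ι) :
      Integrable (fun x => softmax (m + c • innerPi a x) i * ⟪a i, x⟫) (stdGaussian E) :=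
    ((memLp_inner_stdGaussian (a i)).integrable one_le_two).bdd_mul (c := 1)
      ((contDiff_softmax i).continuous.comp haff).aestronglyMeasurable
      (.of_forall fun x => by
        simpa [abs_of_nonneg (softmax_nonneg _ i)] using softmax_le_one (m + c • innerPi a x) i)
  have hfderiv (i : ι) : Integrable (fun x =>
      fderiv ℝ (fun v => softmax v i) (m + c • innerPi a x) (c • innerPi a (a i)))
      (stdGaussian E) :=
    (memLp_fderiv_apply (p := 1) (contDiff_softmax i) (lipschitzWith_softmax i)
      haff.aestronglyMeasurable (memLp_const _)).integrable le_rfl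
  have hsum (x : E) : ∑ i, fderiv ℝ (fun v => softmax v i) (m + c • innerPi a x)
      (c • innerPi a (a i)) = c / 2 * gibbsIncrement a (m + c • innerPi a x) := by
    simp only [map_smul, fderiv_softmax_apply, smul_eq_mul, ← Finset.mul_sum]
    rw [div_mul_eq_mul_div, mul_div_assoc, ← sum_softmax_mul_fderiv]
    rfl
  calc ∫ x, fderiv ℝ logSumExp (m + c • innerPi a x) (innerPi a x) ∂stdGaussian E
      = ∑ i, ∫ x, softmax (m + c • innerPi a x) i * ⟪a i, x⟫ ∂stdGaussian E := by
        rw [← integral_finsetSum _ fun i _ => hsoft i]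
        simp only [fderiv_logSumExp_apply]
        rfl
    _ = c / 2 * ∫ x, gibbsIncrement a (m + c • innerPi a x) ∂stdGaussian E := by
        simp only [integral_softmax_mul_inner_stdGaussian]
        rw [← integral_finsetSum _ fun i _ => hfderiv i, ← integral_const_mul]
        simp only [hsum]

variable {F : Type*} [NormedAddCommGroup F] [InnerProductSpace ℝ F] [FiniteDimensional ℝ F]
  [MeasurableSpace F] [BorelSpace F]

theorem integral_prod_fderiv_logSumExp_innerPi (m : ι → ℝ) (a : ι → E) (b : ι → F) (c s : ℝ) :
    ∫ z, fderiv ℝ logSumExp (m + (c • innerPi a z.1 + s • innerPi b z.2)) (innerPi a z.1)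
        ∂(stdGaussian E).prod (stdGaussian F) =
      c / 2 * ∫ z, gibbsIncrement a (m + (c • innerPi a z.1 + s • innerPi b z.2))
        ∂(stdGaussian E).prod (stdGaussian F) := by
  have hV : Continuous fun z : E × F => m + (c • innerPi a z.1 + s • innerPi b z.2) := by fun_prop
  have ha : MemLp (fun z : E × F => innerPi a z.1) 2 ((stdGaussian E).prod (stdGaussian F)) :=
    (memLp_innerPi a).comp_fst _
  rw [integral_prod_symm _ ((memLp_fderiv_apply contDiff_logSumExp lipschitzWith_logSumExp
      hV.aestronglyMeasurable ha).integrable one_le_two),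
    integral_prod_symm _ (integrable_gibbsIncrement_comp a hV.aestronglyMeasurable)]
  simp only [add_left_comm m, add_comm (c • _), ← add_assoc]
  simp only [integral_fderiv_logSumExp_innerPi, integral_const_mul]

theorem integral_fderiv_logSumExp_interpolation_nonneg (m : ι → ℝ) {a : ι → E} {b : ι → F}
    (h : ∀ i j, ‖a i - a j‖ ≤ ‖b i - b j‖) {c s : ℝ} (hc : 0 ≤ c) (hs : 0 ≤ s) :
    0 ≤ ∫ z, fderiv ℝ logSumExp (m + (c • innerPi a z.1 + s • innerPi b z.2))
      (-s • innerPi a z.1 + c • innerPi b z.2) ∂(stdGaussian E).prod (stdGaussian F) := by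
  set μ := (stdGaussian E).prod (stdGaussian F)
  set V : E × F → ι → ℝ := fun z => m + (c • innerPi a z.1 + s • innerPi b z.2)
  have hV : AEStronglyMeasurable V μ := Continuous.aestronglyMeasurable (by fun_prop)
  have ha : MemLp (fun z : E × F => innerPi a z.1) 2 μ :=
    (memLp_innerPi a).comp_fst _
  have hb : MemLp (fun z : E × F => innerPi b z.2) 2 μ :=
    (memLp_innerPi b).comp_snd _
  have hint {W : E × F → ι → ℝ} (hW : MemLp W 2 μ) :
      Integrable (fun z => fderiv ℝ logSumExp (V z) (W z)) μ :=
    (memLp_fderiv_apply contDiff_logSumExp lipschitzWith_logSumExp hV hW).integrable one_le_two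
  have hfst : ∫ z, fderiv ℝ logSumExp (V z) (innerPi a z.1) ∂μ =
      c / 2 * ∫ z, gibbsIncrement a (V z) ∂μ := integral_prod_fderiv_logSumExp_innerPi m a b c s
  have hsnd : ∫ z, fderiv ℝ logSumExp (V z) (innerPi b z.2) ∂μ =
      s / 2 * ∫ z, gibbsIncrement b (V z) ∂μ := by
    have hswap := integral_prod_fderiv_logSumExp_innerPi m b a s c
    rw [← integral_prod_swap, ← integral_prod_swap (fun z => gibbsIncrement b _)] at hswap
    simpa only [V, Prod.fst_swap, Prod.snd_swap, add_comm (s • _)] using hswap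
  have hmono : ∫ z, gibbsIncrement a (V z) ∂μ ≤ ∫ z, gibbsIncrement b (V z) ∂μ :=
    integral_mono (integrable_gibbsIncrement_comp a hV) (integrable_gibbsIncrement_comp b hV)
      fun z => gibbsIncrement_mono h (V z)
  calc 0 ≤ s * c / 2 * (∫ z, gibbsIncrement b (V z) ∂μ - ∫ z, gibbsIncrement a (V z) ∂μ) :=
        mul_nonneg (by positivity) (sub_nonneg.2 hmono)
    _ = -s * ∫ z, fderiv ℝ logSumExp (V z) (innerPi a z.1) ∂μ +
          c * ∫ z, fderiv ℝ logSumExp (V z) (innerPi b z.2) ∂μ := by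
        rw [hfst, hsnd]
        ring
    _ = _ := by
        simp only [map_add, map_smul, smul_eq_mul]
        rw [integral_add ((hint ha).const_mul _) ((hint hb).const_mul _), integral_const_mul,
          integral_const_mul]

theorem integral_logSumExp_innerPi_le (m : ι → ℝ) {a : ι → E} {b : ι → F}
    (h : ∀ i j, ‖a i - a j‖ ≤ ‖b i - b j‖) :
    ∫ x, logSumExp (m + innerPi a x) ∂stdGaussian E ≤
      ∫ y, logSumExp (m + innerPi b y) ∂stdGaussian F := by
  set μ := (stdGaussian E).prod (stdGaussian F)
  have hdiff : ContDiff ℝ 1 fun v : ι → ℝ => logSumExp (m + v) :=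
    contDiff_logSumExp.comp (by fun_prop)
  have hlip := lipschitzWith_logSumExp.comp ((LipschitzWith.const m).add LipschitzWith.id)
  have ha : MemLp (fun z : E × F => innerPi a z.1) 2 μ :=
    (memLp_innerPi a).comp_fst _
  have hb : MemLp (fun z : E × F => innerPi b z.2) 2 μ :=
    (memLp_innerPi b).comp_snd _
  have hderiv (θ : ℝ) :=
    hasDerivAt_integral_comp_cos_add_sin_mul hdiff hlip ha hb (memLp_const (1 : ℝ)) θ
  simp only [fderiv_comp_add_left, mul_one] at hderiv
  have hmono : MonotoneOn (fun θ => ∫ z, logSumExp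
      (m + (Real.cos θ • innerPi a z.1 + Real.sin θ • innerPi b z.2)) ∂μ)
      (Set.Icc 0 (Real.pi / 2)) := by
    refine monotoneOn_of_hasDerivWithinAt_nonneg (convex_Icc _ _)
      (fun θ _ => (hderiv θ).continuousAt.continuousWithinAt)
      (fun θ _ => (hderiv θ).hasDerivWithinAt) fun θ hθ => ?_
    rw [interior_Icc] at hθ
    exact integral_fderiv_logSumExp_interpolation_nonneg m h
      (Real.cos_nonneg_of_mem_Icc ⟨by linarith [hθ.1, Real.pi_pos], hθ.2.le⟩)
      (Real.sin_nonneg_of_nonneg_of_le_pi hθ.1.le (by linarith [hθ.2, Real.pi_pos]))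
  have hends := hmono (Set.left_mem_Icc.2 (by positivity)) (Set.right_mem_Icc.2 (by positivity))
    (by positivity)
  simpa [μ, integral_fun_fst (fun x => logSumExp (m + innerPi a x)),
    integral_fun_snd (fun y => logSumExp (m + innerPi b y))] using hends

theorem integral_iSup_innerPi_le_add_log_card (m : ι → ℝ) {a : ι → E} {b : ι → F}
    (h : ∀ i j, ‖a i - a j‖ ≤ ‖b i - b j‖) :
    ∫ x, ⨆ i, (m + innerPi a x) i ∂stdGaussian E ≤
      ∫ y, ⨆ i, (m + innerPi b y) i ∂stdGaussian F + Real.log (Fintype.card ι) := by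
  have hmax := integrable_comp_add_innerPi lipschitzWith_iSup m b
  calc ∫ x, ⨆ i, (m + innerPi a x) i ∂stdGaussian E
      ≤ ∫ x, logSumExp (m + innerPi a x) ∂stdGaussian E :=
        integral_mono (integrable_comp_add_innerPi lipschitzWith_iSup m a)
          (integrable_comp_add_innerPi lipschitzWith_logSumExp m a) fun x => iSup_le_logSumExp _
    _ ≤ ∫ y, logSumExp (m + innerPi b y) ∂stdGaussian F := integral_logSumExp_innerPi_le m h
    _ ≤ ∫ y, ((⨆ i, (m + innerPi b y) i) + Real.log (Fintype.card ι)) ∂stdGaussian F :=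
        integral_mono (integrable_comp_add_innerPi lipschitzWith_logSumExp m b)
          (hmax.add (integrable_const _)) fun y => logSumExp_le_iSup_add_log_card _
    _ = ∫ y, ⨆ i, (m + innerPi b y) i ∂stdGaussian F + Real.log (Fintype.card ι) := by
        rw [integral_add hmax (integrable_const _)]
        simp

end SudakovFernique

section SudakovFerniqueSequence

variable {E F : Type*} [NormedAddCommGroup E] [InnerProductSpace ℝ E] [FiniteDimensional ℝ E]
  [MeasurableSpace E] [BorelSpace E] [NormedAddCommGroup F] [InnerProductSpace ℝ F]
  [FiniteDimensional ℝ F] [MeasurableSpace F] [BorelSpace F]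

theorem integral_iSup_innerPi_le {ι : Type*} [Finite ι] [Nonempty ι] (m : ι → ℝ)
    {a : ι → E} {b : ι → F} (h : ∀ i j, ‖a i - a j‖ ≤ ‖b i - b j‖) :
    ∫ x, ⨆ i, (m + innerPi a x) i ∂stdGaussian E ≤
      ∫ y, ⨆ i, (m + innerPi b y) i ∂stdGaussian F := by
  have := Fintype.ofFinite ι
  by_contra! hlt
  obtain ⟨r, hr⟩ := exists_nat_gt (Real.log (Fintype.card ι) /
    (∫ x, ⨆ i, (m + innerPi a x) i ∂stdGaussian E - ∫ y, ⨆ i, (m + innerPi b y) i ∂stdGaussian F))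
  have hscaled := integral_iSup_innerPi_le_add_log_card ((r : ℝ) • m) (a := (r : ℝ) • a)
    (b := (r : ℝ) • b) fun i j => by
      simp only [Pi.smul_apply, ← smul_sub, norm_smul]
      exact mul_le_mul_of_nonneg_left (h i j) (norm_nonneg _)
  simp only [iSup_smul_add_innerPi_smul _ _ r.cast_nonneg, integral_const_mul] at hscaled
  rw [div_lt_iff₀ (sub_pos.2 hlt)] at hr
  linarith

theorem tendsto_iSup_fin_of_isLUB {u : ℕ → ℝ} {s : ℝ} (hs : IsLUB (Set.range u) s) :
    Filter.Tendsto (fun N => ⨆ i : Fin (N + 1), u i) Filter.atTop (𝓝 s) := by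
  have hbdd (N : ℕ) : BddAbove (Set.range fun i : Fin (N + 1) => u i) :=
    (Set.finite_range _).bddAbove
  refine tendsto_atTop_isLUB (fun N M hNM => ?_) ⟨?_, fun r hr => hs.2 ?_⟩
  · exact ciSup_le fun i => le_ciSup (hbdd M) (Fin.castLE (by lia) i)
  · rintro _ ⟨N, rfl⟩
    exact ciSup_le fun i => hs.1 ⟨i, rfl⟩
  · rintro _ ⟨i, rfl⟩
    exact (le_ciSup (hbdd i) (Fin.last i)).trans (hr ⟨i, rfl⟩)

theorem sudakov_fernique_of_isLUB (m : ℕ → ℝ) {a : ℕ → E} {b : ℕ → F}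
    (h : ∀ i j, ‖a i - a j‖ ≤ ‖b i - b j‖) {A : E → ℝ} {B : F → ℝ}
    (hA : ∀ x, IsLUB (Set.range fun i => m i + ⟪a i, x⟫) (A x))
    (hB : ∀ y i, m i + ⟪b i, y⟫ ≤ B y) (hAint : Integrable A (stdGaussian E))
    (hBint : Integrable B (stdGaussian F)) :
    ∫ x, A x ∂stdGaussian E ≤ ∫ y, B y ∂stdGaussian F := by
  have hfirst (N : ℕ) (x : E) : m 0 + ⟪a 0, x⟫ ≤ ⨆ i : Fin (N + 1), (m i + ⟪a i, x⟫) :=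
    le_ciSup (f := fun i : Fin (N + 1) => m i + ⟪a i, x⟫) (Set.finite_range _).bddAbove 0
  have hint (N : ℕ) :
      Integrable (fun x => ⨆ i : Fin (N + 1), (m i + ⟪a i, x⟫)) (stdGaussian E) :=
    integrable_comp_add_innerPi lipschitzWith_iSup (fun i : Fin (N + 1) => m i) fun i => a i
  have hlim : Filter.Tendsto
      (fun N => ∫ x, ⨆ i : Fin (N + 1), (m i + ⟪a i, x⟫) ∂stdGaussian E) Filter.atTop
      (𝓝 (∫ x, A x ∂stdGaussian E)) := by
    refine tendsto_integral_of_dominated_convergence (fun x => |m 0 + ⟪a 0, x⟫| + |A x|)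
      (fun N => (hint N).1) ?_ (fun N => .of_forall fun x => ?_)
      (.of_forall fun x => tendsto_iSup_fin_of_isLUB (hA x))
    · exact (((integrable_const (m 0)).add
        ((memLp_inner_stdGaussian (a 0)).integrable one_le_two)).abs).add hAint.abs
    · have hupper : ⨆ i : Fin (N + 1), (m i + ⟪a i, x⟫) ≤ A x :=
        ciSup_le fun i => (hA x).1 ⟨i, rfl⟩
      exact (abs_le_max_abs_abs (hfirst N x) hupper).trans
        (max_le_add_of_nonneg (abs_nonneg _) (abs_nonneg _))
  refine le_of_tendsto' hlim fun N => ?_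
  calc ∫ x, ⨆ i : Fin (N + 1), (m i + ⟪a i, x⟫) ∂stdGaussian E
      ≤ ∫ y, ⨆ i : Fin (N + 1), (m i + ⟪b i, y⟫) ∂stdGaussian F :=
        integral_iSup_innerPi_le (fun i : Fin (N + 1) => m i) fun i j => h i j
    _ ≤ ∫ y, B y ∂stdGaussian F :=
        integral_mono (integrable_comp_add_innerPi lipschitzWith_iSup
          (fun i : Fin (N + 1) => m i) fun i => b i) hBint fun y => ciSup_le fun i => hB y i

end SudakovFerniqueSequence

section Banach

theorem norm_update_eq_one {ι E : Type*} [DecidableEq ι] [Norm E] {u : ι → E}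
    (hu : ∀ l, ‖u l‖ = 1) (i : ι) {x : E} (hx : ‖x‖ = 1) (l : ι) :
    ‖Function.update u i x l‖ = 1 := by
  rcases eq_or_ne l i with rfl | h
  · rwa [Function.update_self]
  · rw [Function.update_of_ne h, hu]

theorem sum_update {ι A : Type*} [Fintype ι] [DecidableEq ι] [AddCommGroup A] (u : ι → A)
    (i : ι) (x : A) : ∑ l, Function.update u i x l = ∑ l, u l + (x - u i) := by
  rw [Finset.sum_update_of_mem (Finset.mem_univ i), ← Finset.add_sum_erase _ u (Finset.mem_univ i),
    Finset.sdiff_singleton_eq_erase]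
  abel

open NormedSpace (normalize norm_smul_normalize norm_normalize_eq_one_iff)

variable {E : Type*} [NormedAddCommGroup E] [InnerProductSpace ℝ E]

theorem mul_norm_add_sq_le_abs_apply_add {B : LinearMap.BilinForm ℝ E} (hB : B.IsSymm) {C : ℝ}
    (hC : ∀ x, |B x x| ≤ C * ‖x‖ ^ 2) {u v : E} (hu : ‖u‖ = 1) (hv : ‖v‖ = 1)
    (huv : C ≤ |B u v|) : C * ‖u + v‖ ^ 2 ≤ |B (u + v) (u + v)| := by
  have polarization : 4 * B u v = B (u + v) (u + v) - B (u - v) (u - v) := by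
    simp only [map_add, map_sub, LinearMap.add_apply, LinearMap.sub_apply, hB.eq v u]
    ring
  have parallelogram : ‖u + v‖ ^ 2 + ‖u - v‖ ^ 2 = 4 := by
    have := parallelogram_law_with_norm ℝ u v
    rw [hu, hv] at this
    linarith
  have key : 4 * C ≤ |B (u + v) (u + v)| + C * ‖u - v‖ ^ 2 := by
    calc 4 * C ≤ |4 * B u v| := by rw [abs_mul]; norm_num [huv]
      _ ≤ |B (u + v) (u + v)| + |B (u - v) (u - v)| := polarization ▸ abs_sub _ _
      _ ≤ |B (u + v) (u + v)| + C * ‖u - v‖ ^ 2 := by gcongr; exact hC _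
  linear_combination key + C * parallelogram

variable {ι : Type*}

/-- The bilinear form obtained from the multilinear form `M` by freezing all arguments except the
two distinct ones `i` and `j`. -/
def bilinSlice [DecidableEq ι] (M : MultilinearMap ℝ (fun _ : ι => E) ℝ) (u : ι → E) {i j : ι}
    (hij : i ≠ j) : LinearMap.BilinForm ℝ E :=
  LinearMap.mk₂ ℝ (fun x y => M (Function.update (Function.update u i x) j y))
    (fun x x' y => by simp only [Function.update_comm hij, M.map_update_add])
    (fun c x y => by simp only [Function.update_comm hij, M.map_update_smul])
    (fun x y y' => M.map_update_add _ _ _ _) (fun c x y => M.map_update_smul _ _ _ _)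

theorem bilinSlice_apply [DecidableEq ι] (M : MultilinearMap ℝ (fun _ : ι => E) ℝ) (u : ι → E)
    {i j : ι} (hij : i ≠ j) (x y : E) :
    bilinSlice M u hij x y = M (Function.update (Function.update u i x) j y) := rfl

theorem isSymm_bilinSlice [DecidableEq ι] {M : MultilinearMap ℝ (fun _ : ι => E) ℝ}
    (hM : ∀ (σ : Equiv.Perm ι) (u : ι → E), M (u ∘ σ) = M u) (u : ι → E) {i j : ι} (hij : i ≠ j) :
    (bilinSlice M u hij).IsSymm where
  eq x y := by
    rw [bilinSlice_apply, bilinSlice_apply, ← hM (Equiv.swap i j)]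
    congr 1
    ext l
    rcases eq_or_ne l i with rfl | hi
    · simp [hij]
    · rcases eq_or_ne l j with rfl | hj
      · simp [hij]
      · simp [Equiv.swap_apply_of_ne_of_ne hi hj, hi, hj]

theorem abs_bilinSlice_self_le [DecidableEq ι] {M : MultilinearMap ℝ (fun _ : ι => E) ℝ} {C : ℝ}
    (hC : ∀ u : ι → E, (∀ j, ‖u j‖ = 1) → |M u| ≤ C) {u : ι → E} (hu : ∀ j, ‖u j‖ = 1)
    {i j : ι} (hij : i ≠ j) (x : E) : |bilinSlice M u hij x x| ≤ C * ‖x‖ ^ 2 := by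
  rcases eq_or_ne x 0 with rfl | hx
  · simp
  have hnorm : ‖normalize x‖ = 1 := norm_normalize_eq_one_iff.2 hx
  calc |bilinSlice M u hij x x|
      = |bilinSlice M u hij (‖x‖ • normalize x) (‖x‖ • normalize x)| := by
        rw [norm_smul_normalize]
    _ = |bilinSlice M u hij (normalize x) (normalize x)| * ‖x‖ ^ 2 := by
        simp only [map_smul, LinearMap.smul_apply, smul_eq_mul, abs_mul, abs_norm]
        ring
    _ ≤ C * ‖x‖ ^ 2 := by
        gcongr
        exact hC _ (norm_update_eq_one (norm_update_eq_one hu i hnorm) j hnorm)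

theorem le_abs_update_normalize_add [DecidableEq ι] {M : MultilinearMap ℝ (fun _ : ι => E) ℝ}
    (hM : ∀ (σ : Equiv.Perm ι) (u : ι → E), M (u ∘ σ) = M u) {u : ι → E} (hu : ∀ j, ‖u j‖ = 1)
    (hmax : ∀ w : ι → E, (∀ j, ‖w j‖ = 1) → |M w| ≤ |M u|) {i j : ι} (hij : i ≠ j)
    (hne : u i + u j ≠ 0) :
    |M u| ≤ |M (Function.update (Function.update u i (normalize (u i + u j))) j
      (normalize (u i + u j)))| := by
  have h := mul_norm_add_sq_le_abs_apply_add (isSymm_bilinSlice hM u hij)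
    (abs_bilinSlice_self_le hmax hu hij) (hu i) (hu j) (by simp [bilinSlice_apply])
  rw [← bilinSlice_apply M u hij]
  have hpos : 0 < ‖u i + u j‖ ^ 2 := by positivity
  refine le_of_mul_le_mul_right (h.trans_eq ?_) hpos
  conv_lhs => rw [← norm_smul_normalize (u i + u j)]
  simp only [map_smul, LinearMap.smul_apply, smul_eq_mul, abs_mul, abs_norm]
  ring

section Fintype

variable [Fintype ι]

theorem abs_le_mul_prod_norm_of_unit_bound (M : MultilinearMap ℝ (fun _ : ι => E) ℝ) {C : ℝ}
    (hC : ∀ u : ι → E, (∀ j, ‖u j‖ = 1) → |M u| ≤ C) (u : ι → E) :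
    |M u| ≤ C * ∏ j, ‖u j‖ := by
  by_cases h0 : ∃ j, u j = 0
  · obtain ⟨j, hj⟩ := h0
    rw [M.map_coord_zero j hj, Finset.prod_eq_zero (Finset.mem_univ j) (by simp [hj])]
    simp
  · push Not at h0
    calc |M u| = |M fun j => ‖u j‖ • normalize (u j)| := by simp only [norm_smul_normalize]
      _ = |M fun j => normalize (u j)| * ∏ j, ‖u j‖ := by
        rw [M.map_smul_univ, smul_eq_mul, abs_mul, mul_comm, Finset.abs_prod]
        simp only [abs_norm]
      _ ≤ C * ∏ j, ‖u j‖ := by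
        gcongr
        exact hC _ fun j => norm_normalize_eq_one_iff.2 (h0 j)

theorem one_le_inner_sum_of_norm_sum_update_neg_le [DecidableEq ι] {u : ι → E} {i : ι}
    (hu : ‖u i‖ = 1) (h : ‖∑ l, Function.update u i (-u i) l‖ ≤ ‖∑ l, u l‖) :
    1 ≤ ⟪∑ l, u l, u i⟫ := by
  have hsum : ∑ l, Function.update u i (-u i) l = ∑ l, u l - (2 : ℝ) • u i := by
    rw [sum_update]
    module
  have hsq := pow_le_pow_left₀ (norm_nonneg _) h 2
  rw [hsum, norm_sub_sq_real, inner_smul_right, norm_smul, hu] at hsq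
  norm_num at hsq
  linarith

theorem norm_sum_lt_norm_sum_update_normalize_add [DecidableEq ι] {u : ι → E} {i j : ι}
    (hui : ‖u i‖ = 1) (huj : ‖u j‖ = 1) (hij : u i ≠ u j) (hS : 0 < ⟪∑ l, u l, u i + u j⟫) :
    ‖∑ l, u l‖ < ‖∑ l, Function.update (Function.update u i (normalize (u i + u j))) j
      (normalize (u i + u j)) l‖ := by
  have hne : u i + u j ≠ 0 := fun h => by simp [h] at hS
  have hpos : 0 < ‖u i + u j‖ := norm_pos_iff.2 hne
  have hlt : ‖u i + u j‖ < 2 := by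
    have hdiff : 0 < ‖u i - u j‖ := norm_pos_iff.2 (sub_ne_zero.2 hij)
    have := parallelogram_law_with_norm ℝ (u i) (u j)
    rw [hui, huj] at this
    nlinarith
  set c := 2 * ‖u i + u j‖⁻¹ - 1
  have hc : 0 < c := by
    have : 1 < 2 * ‖u i + u j‖⁻¹ := by rwa [← div_eq_mul_inv, one_lt_div hpos]
    linarith
  have hsum : ∑ l, Function.update (Function.update u i (normalize (u i + u j))) j
      (normalize (u i + u j)) l = ∑ l, u l + c • (u i + u j) := by
    rw [sum_update, sum_update, Function.update_of_ne fun h => hij (congrArg u h.symm),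
      NormedSpace.normalize]
    module
  refine lt_of_pow_lt_pow_left₀ 2 (norm_nonneg _) ?_
  rw [hsum, norm_add_sq_real, inner_smul_right]
  linarith [mul_pos hc hS, sq_nonneg ‖c • (u i + u j)‖]

theorem exists_max_abs_max_norm_sum [FiniteDimensional ℝ E] [Nontrivial E] {f : (ι → E) → ℝ}
    (hf : Continuous f) :
    ∃ u : ι → E, (∀ j, ‖u j‖ = 1) ∧ (∀ w : ι → E, (∀ j, ‖w j‖ = 1) → |f w| ≤ |f u|) ∧
      ∀ w : ι → E, (∀ j, ‖w j‖ = 1) → |f u| ≤ |f w| → ‖∑ j, w j‖ ≤ ‖∑ j, u j‖ := by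
  have hcompact : IsCompact {u : ι → E | ∀ j, ‖u j‖ = 1} := by
    convert isCompact_univ_pi fun _ : ι => isCompact_sphere (0 : E) 1 using 1
    ext u
    simp [Set.mem_pi]
  obtain ⟨x, hx⟩ := exists_norm_eq E zero_le_one
  obtain ⟨u₀, hu₀, hmax⟩ := hcompact.exists_isMaxOn ⟨fun _ => x, fun _ => hx⟩
    hf.abs.continuousOn
  have hclosed : IsClosed {u : ι → E | |f u₀| ≤ |f u|} := isClosed_le continuous_const hf.abs
  obtain ⟨u, ⟨hu, huC⟩, humax⟩ := (hcompact.inter_right hclosed).exists_isMaxOn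
    ⟨u₀, hu₀, le_refl |f u₀|⟩ (f := fun u : ι → E => ‖∑ j, u j‖) (by fun_prop)
  exact ⟨u, hu, fun w hw => (hmax hw).trans huC, fun w hw huw => humax ⟨hw, huC.trans huw⟩⟩

end Fintype

/- Banach's theorem. Among the unit tuples maximizing `|M|`, take one with `‖∑ j, u j‖` largest. If
`u i ≠ u j`, replacing both by the normalization of `u i + u j` keeps `|M|` maximal, by
polarization, and strictly increases `‖∑ j, u j‖`. -/
theorem exists_abs_le_abs_diagonal [Finite ι] [Nonempty ι] [FiniteDimensional ℝ E] [Nontrivial E]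
    {M : MultilinearMap ℝ (fun _ : ι => E) ℝ} (hcont : Continuous M)
    (hM : ∀ (σ : Equiv.Perm ι) (u : ι → E), M (u ∘ σ) = M u) :
    ∃ v : E, ‖v‖ = 1 ∧ ∀ u : ι → E, (∀ j, ‖u j‖ ≤ 1) → |M u| ≤ |M fun _ => v| := by
  classical
  have := Fintype.ofFinite ι
  obtain ⟨u, hu, hmax, hsum⟩ := exists_max_abs_max_norm_sum hcont
  have hinner : ∀ i, 1 ≤ ⟪∑ l, u l, u i⟫ := fun i =>
    one_le_inner_sum_of_norm_sum_update_neg_le (hu i) <|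
      hsum _ (norm_update_eq_one hu i (by rw [norm_neg, hu])) <| by
        rw [← neg_one_smul ℝ (u i), M.map_update_smul, Function.update_eq_self]
        simp
  have hconst : ∀ i j, u i = u j := by
    intro i j
    by_contra hij
    have hS : 0 < ⟪∑ l, u l, u i + u j⟫ := by
      rw [inner_add_right]
      linarith [hinner i, hinner j]
    have hne : u i + u j ≠ 0 := fun h => by simp [h] at hS
    have hz := norm_normalize_eq_one_iff.2 hne
    exact (norm_sum_lt_norm_sum_update_normalize_add (hu i) (hu j) hij hS).not_ge <|
      hsum _ (norm_update_eq_one (norm_update_eq_one hu i hz) j hz) <|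
        le_abs_update_normalize_add hM hu hmax (fun h => hij (congrArg u h)) hne
  obtain ⟨i⟩ := ‹Nonempty ι›
  refine ⟨u i, hu i, fun w hw => ?_⟩
  rw [funext fun j => hconst i j]
  exact (abs_le_mul_prod_norm_of_unit_bound M hmax w).trans <| mul_le_of_le_one_right
    (abs_nonneg _) (Finset.prod_le_one (fun _ _ => norm_nonneg _) fun j _ => hw j)

end Banach

section OperatorNorm

variable {k n : ℕ}

theorem tinner_eq_inner (X Y : Tensor k n) :
    tinner X Y = ⟪(WithLp.toLp 2 X : EuclideanSpace ℝ (Fin k → Fin n)), WithLp.toLp 2 Y⟫ := by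
  simp [tinner, PiLp.inner_apply, mul_comm]

theorem tinner_outer_outer (u w : Fin k → EuclideanSpace ℝ (Fin n)) :
    tinner (outer u) (outer w) = ∏ j, ⟪u j, w j⟫ := by
  simp only [tinner, outer, ← Finset.prod_mul_distrib, PiLp.inner_apply, RCLike.inner_apply,
    conj_trivial, mul_comm (u _ _), Finset.prod_univ_sum, Fintype.piFinset_univ]

theorem tinner_permute_outer (X : Tensor k n) (σ : Equiv.Perm (Fin k))
    (u : Fin k → EuclideanSpace ℝ (Fin n)) :
    tinner (permute σ X) (outer u) = tinner X (outer (u ∘ σ)) := by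
  refine Fintype.sum_equiv (Equiv.arrowCongr σ.symm (Equiv.refl _)) _ _ fun i => ?_
  exact congrArg (X (i ∘ σ) * ·) (Equiv.prod_comp σ fun j => u j (i j)).symm

theorem norm_toLp_permute (σ : Equiv.Perm (Fin k)) (X : Tensor k n) :
    ‖(WithLp.toLp 2 (permute σ X) : EuclideanSpace ℝ (Fin k → Fin n))‖ =
      ‖(WithLp.toLp 2 X : EuclideanSpace ℝ (Fin k → Fin n))‖ := by
  rw [EuclideanSpace.norm_eq, EuclideanSpace.norm_eq]
  congr 1
  exact Fintype.sum_equiv (Equiv.arrowCongr σ.symm (Equiv.refl _)) _ _ fun i => rfl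

theorem norm_toLp_outer (u : Fin k → EuclideanSpace ℝ (Fin n)) :
    ‖(WithLp.toLp 2 (outer u) : EuclideanSpace ℝ (Fin k → Fin n))‖ = ∏ j, ‖u j‖ := by
  rw [norm_eq_sqrt_real_inner, ← tinner_eq_inner, tinner_outer_outer]
  simp only [real_inner_self_eq_norm_sq, Finset.prod_pow]
  exact Real.sqrt_sq (Finset.prod_nonneg fun _ _ => norm_nonneg _)

theorem abs_opNorm_sub_opNorm_le (X Y : Tensor k n) : |opNorm X - opNorm Y| ≤
    ‖(WithLp.toLp 2 X - WithLp.toLp 2 Y : EuclideanSpace ℝ (Fin k → Fin n))‖ := by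
  have hsub (X Y : Tensor k n) : opNorm X - opNorm Y ≤
      ‖(WithLp.toLp 2 X - WithLp.toLp 2 Y : EuclideanSpace ℝ (Fin k → Fin n))‖ := by
    obtain ⟨⟨u, hu, hX⟩, -⟩ := isGreatest_opNorm X
    have hY : tinner Y (outer u) ≤ opNorm Y := (isGreatest_opNorm Y).2 ⟨u, hu, rfl⟩
    calc opNorm X - opNorm Y ≤ tinner X (outer u) - tinner Y (outer u) := by linarith
      _ = ⟪WithLp.toLp 2 X - WithLp.toLp 2 Y, WithLp.toLp 2 (outer u)⟫ := by
        rw [tinner_eq_inner, tinner_eq_inner, ← inner_sub_left]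
      _ ≤ _ * ‖(WithLp.toLp 2 (outer u) : EuclideanSpace ℝ (Fin k → Fin n))‖ :=
        real_inner_le_norm _ _
      _ ≤ _ := mul_le_of_le_one_right (norm_nonneg _) <| by
        rw [norm_toLp_outer]
        exact Finset.prod_le_one (fun _ _ => norm_nonneg _) fun j _ => hu j
  exact abs_sub_le_iff.2 ⟨hsub X Y, (hsub Y X).trans_eq (norm_sub_rev _ _)⟩

theorem norm_toLp_symNoise_le (G : Tensor k n) :
    ‖(WithLp.toLp 2 (symNoise G) : EuclideanSpace ℝ (Fin k → Fin n))‖ ≤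
      √((k : ℝ) / n) * ‖(WithLp.toLp 2 G : EuclideanSpace ℝ (Fin k → Fin n))‖ := by
  have hk : (k.factorial : ℝ) ≠ 0 := by exact_mod_cast k.factorial_ne_zero
  rw [symNoise, WithLp.toLp_smul, WithLp.toLp_sum, norm_smul, Real.norm_of_nonneg (by positivity)]
  calc _ ≤ 1 / (k.factorial : ℝ) * √((k : ℝ) / n) * ∑ π : Equiv.Perm (Fin k),
        ‖(WithLp.toLp 2 (permute π G) : EuclideanSpace ℝ (Fin k → Fin n))‖ := by
        gcongr
        exact norm_sum_le _ _
    _ = _ := by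
        simp only [norm_toLp_permute, Finset.sum_const, Finset.card_univ, Fintype.card_perm,
          Fintype.card_fin, nsmul_eq_mul]
        field_simp

theorem spiked_sub_spiked (β : ℝ) (v₀ : EuclideanSpace ℝ (Fin n)) (G G' : Tensor k n) :
    spiked β v₀ G - spiked β v₀ G' = symNoise (G - G') := by
  simp only [spiked, symNoise, add_sub_add_left_eq_sub, ← smul_sub, ← Finset.sum_sub_distrib]
  rfl

theorem lipschitzWith_opNorm_spiked (β : ℝ) (v₀ : EuclideanSpace ℝ (Fin n)) :
    LipschitzWith (NNReal.sqrt (k / n)) fun x : EuclideanSpace ℝ (Fin k → Fin n) =>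
      opNorm (spiked β v₀ x.ofLp) := by
  refine LipschitzWith.of_dist_le_mul fun x y => ?_
  rw [Real.dist_eq, dist_eq_norm]
  refine (abs_opNorm_sub_opNorm_le _ _).trans ?_
  rw [← WithLp.toLp_sub, spiked_sub_spiked]
  simpa using norm_toLp_symNoise_le (x.ofLp - y.ofLp)

/-- The multilinear form `u ↦ ⟨X, u₁ ⊗ ⋯ ⊗ uₖ⟩`. -/
noncomputable def tensorForm (X : Tensor k n) :
    MultilinearMap ℝ (fun _ : Fin k => EuclideanSpace ℝ (Fin n)) ℝ :=
  ∑ i : Fin k → Fin n, X i • (MultilinearMap.mkPiAlgebra ℝ (Fin k) ℝ).compLinearMap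
    fun j => (EuclideanSpace.proj (i j) : EuclideanSpace ℝ (Fin n) →L[ℝ] ℝ).toLinearMap

theorem tensorForm_apply (X : Tensor k n) (u : Fin k → EuclideanSpace ℝ (Fin n)) :
    tensorForm X u = tinner X (outer u) := by
  simp [tensorForm, tinner, outer]

theorem continuous_tensorForm (X : Tensor k n) : Continuous (tensorForm X) := by
  simp only [funext (tensorForm_apply X), tinner, outer]
  fun_prop

theorem exists_opNorm_le_abs_tinner_outerPow (hk : 1 ≤ k) (hn : 1 ≤ n) {X : Tensor k n}
    (hX : ∀ σ, permute σ X = X) :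
    ∃ v : EuclideanSpace ℝ (Fin n), ‖v‖ = 1 ∧ opNorm X ≤ |tinner X (outerPow k v)| := by
  have : Nonempty (Fin k) := ⟨⟨0, hk⟩⟩
  have : Nonempty (Fin n) := ⟨⟨0, hn⟩⟩
  obtain ⟨v, hv, hmax⟩ := exists_abs_le_abs_diagonal (continuous_tensorForm X) fun σ u => by
    rw [tensorForm_apply, tensorForm_apply, ← tinner_permute_outer, hX]
  obtain ⟨⟨w, hw, hwX⟩, -⟩ := isGreatest_opNorm X
  refine ⟨v, hv, ?_⟩
  calc opNorm X ≤ |tensorForm X w| := by rw [tensorForm_apply, ← hwX]; exact le_abs_self _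
    _ ≤ |tinner X (outerPow k v)| := (hmax w hw).trans_eq (by rw [tensorForm_apply, outerPow])

theorem abs_tinner_outerPow_le_opNorm (hk : 1 ≤ k) (X : Tensor k n)
    {v : EuclideanSpace ℝ (Fin n)} (hv : ‖v‖ = 1) : |tinner X (outerPow k v)| ≤ opNorm X := by
  have hmem {u : Fin k → EuclideanSpace ℝ (Fin n)} (hu : ∀ j, ‖u j‖ = 1) :
      tinner X (outer u) ≤ opNorm X := (isGreatest_opNorm X).2 ⟨u, fun j => (hu j).le, rfl⟩
  refine abs_le'.2 ⟨hmem fun _ => hv, ?_⟩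
  calc -tinner X (outerPow k v)
      = tinner X (outer (Function.update (fun _ => v) ⟨0, hk⟩ (-v))) := by
        rw [← tensorForm_apply, ← neg_one_smul ℝ v, MultilinearMap.map_update_smul,
          Function.update_eq_self, tensorForm_apply, neg_one_smul, outerPow]
    _ ≤ opNorm X := hmem (norm_update_eq_one (fun _ => hv) _ (by rwa [norm_neg]))

end OperatorNorm

section SignedSphere

variable {k n : ℕ}

/-- Pairs of a sign and a unit vector. The sign turns the maximum of `|⟨X, v^{⊗k}⟩|` over unit
vectors, which is the operator norm of a symmetric tensor, into a maximum of values linear in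
`X`. -/
abbrev SignedSphere (n : ℕ) : Type := ℤˣ × Metric.sphere (0 : EuclideanSpace ℝ (Fin n)) 1

namespace SignedSphere

/-- The sign of a signed unit vector, as a real number. -/
def sign (p : SignedSphere n) : ℝ := ((p.1 : ℤ) : ℝ)

/-- The underlying unit vector of a signed unit vector. -/
def vec (p : SignedSphere n) : EuclideanSpace ℝ (Fin n) := p.2

theorem norm_vec (p : SignedSphere n) : ‖p.vec‖ = 1 :=
  mem_sphere_zero_iff_norm.1 p.2.2

theorem sign_eq (p : SignedSphere n) : p.sign = 1 ∨ p.sign = -1 := by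
  rcases Int.units_eq_one_or p.1 with h | h <;> simp [sign, h]

theorem abs_sign (p : SignedSphere n) : |p.sign| = 1 := by
  rcases p.sign_eq with h | h <;> simp [h]

theorem abs_inner_le (p q : SignedSphere n) : |⟪p.vec, q.vec⟫| ≤ 1 := by
  simpa [p.norm_vec, q.norm_vec] using abs_real_inner_le_norm p.vec q.vec

theorem continuous_sign : Continuous (sign (n := n)) :=
  (continuous_of_discreteTopology (f := fun u : ℤˣ => ((u : ℤ) : ℝ))).comp continuous_fst

theorem continuous_vec : Continuous (vec (n := n)) :=
  continuous_subtype_val.comp continuous_snd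

theorem nonempty (hn : 1 ≤ n) : Nonempty (SignedSphere n) := by
  have : Nonempty (Fin n) := ⟨⟨0, hn⟩⟩
  obtain ⟨x, hx⟩ := exists_norm_eq (EuclideanSpace ℝ (Fin n)) zero_le_one
  exact ⟨(1, ⟨x, by simpa using hx⟩)⟩

end SignedSphere

theorem isLUB_sign_mul_tinner_outerPow (hk : 1 ≤ k) (hn : 1 ≤ n) {X : Tensor k n}
    (hX : ∀ σ, permute σ X = X) :
    IsLUB (Set.range fun p : SignedSphere n => p.sign * tinner X (outerPow k p.vec))
      (opNorm X) := by
  refine ⟨?_, fun c hc => ?_⟩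
  · rintro _ ⟨p, rfl⟩
    calc p.sign * tinner X (outerPow k p.vec) ≤ |p.sign * tinner X (outerPow k p.vec)| :=
          le_abs_self _
      _ ≤ opNorm X := by
          rw [abs_mul, p.abs_sign, one_mul]
          exact abs_tinner_outerPow_le_opNorm hk X p.norm_vec
  · obtain ⟨v, hv, hmax⟩ := exists_opNorm_le_abs_tinner_outerPow hk hn hX
    have hmem (ε : ℤˣ) : ((ε : ℤ) : ℝ) * tinner X (outerPow k v) ≤ c :=
      hc ⟨(ε, ⟨v, mem_sphere_zero_iff_norm.2 hv⟩), rfl⟩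
    exact hmax.trans (abs_le'.2 ⟨by simpa using hmem 1, by simpa using hmem (-1)⟩)

theorem permute_outerPow (σ : Equiv.Perm (Fin k)) (v : EuclideanSpace ℝ (Fin n)) :
    permute σ (outerPow k v) = outerPow k v :=
  funext fun i => Equiv.prod_comp σ fun j => v (i j)

theorem permute_symNoise (σ : Equiv.Perm (Fin k)) (G : Tensor k n) :
    permute σ (symNoise G) = symNoise G := by
  ext i
  simp only [symNoise, permute, Pi.smul_apply, Finset.sum_apply]
  congr 1
  exact Fintype.sum_equiv (Equiv.mulLeft σ) _ _ fun π => rfl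

theorem permute_spiked (β : ℝ) (v₀ : EuclideanSpace ℝ (Fin n)) (G : Tensor k n)
    (σ : Equiv.Perm (Fin k)) : permute σ (spiked β v₀ G) = spiked β v₀ G := by
  calc permute σ (spiked β v₀ G)
      = β • permute σ (outerPow k v₀) + permute σ (symNoise G) := rfl
    _ = spiked β v₀ G := by rw [permute_outerPow, permute_symNoise, spiked]

theorem tinner_spiked_outerPow (β : ℝ) (v₀ v : EuclideanSpace ℝ (Fin n)) (G : Tensor k n) :
    tinner (spiked β v₀ G) (outerPow k v) =
      β * ⟪v₀, v⟫ ^ k + √((k : ℝ) / n) * tinner G (outerPow k v) := by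
  have hk : (k.factorial : ℝ) ≠ 0 := by exact_mod_cast k.factorial_ne_zero
  have hperm (π : Equiv.Perm (Fin k)) :
      tinner (permute π G) (outerPow k v) = tinner G (outerPow k v) :=
    tinner_permute_outer G π _
  have hspike : tinner (outerPow k v₀) (outerPow k v) = ⟪v₀, v⟫ ^ k := by
    simp [outerPow, tinner_outer_outer]
  simp only [tinner_eq_inner] at hperm hspike ⊢
  simp only [spiked, symNoise, WithLp.toLp_add, WithLp.toLp_smul, WithLp.toLp_sum, inner_add_left,
    real_inner_smul_left, sum_inner, hperm, hspike, Finset.sum_const, Finset.card_univ,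
    Fintype.card_perm, Fintype.card_fin, nsmul_eq_mul]
  field_simp

/-- The mean of the Gaussian process `p ↦ p.sign * ⟨X, p.vec^{⊗k}⟩`. -/
noncomputable def processMean (k : ℕ) (β : ℝ) (v₀ : EuclideanSpace ℝ (Fin n))
    (p : SignedSphere n) : ℝ := p.sign * (β * ⟪v₀, p.vec⟫ ^ k)

/-- The coefficient vectors of the Gaussian process `p ↦ p.sign * ⟨X, p.vec^{⊗k}⟩`. -/
noncomputable def processCoeff (k : ℕ) (p : SignedSphere n) : EuclideanSpace ℝ (Fin k → Fin n) :=
  (p.sign * √((k : ℝ) / n)) • WithLp.toLp 2 (outerPow k p.vec)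

theorem processMean_add_inner_processCoeff (β : ℝ) (v₀ : EuclideanSpace ℝ (Fin n))
    (p : SignedSphere n) (x : EuclideanSpace ℝ (Fin k → Fin n)) :
    processMean k β v₀ p + ⟪processCoeff k p, x⟫ =
      p.sign * tinner (spiked β v₀ x.ofLp) (outerPow k p.vec) := by
  rw [tinner_spiked_outerPow, processMean, processCoeff, real_inner_smul_left, tinner_eq_inner,
    WithLp.toLp_ofLp, real_inner_comm (WithLp.toLp 2 (outerPow k p.vec)) x]
  ring

theorem isLUB_opNorm_spiked (hk : 1 ≤ k) (hn : 1 ≤ n) (β : ℝ) (v₀ : EuclideanSpace ℝ (Fin n))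
    {d : ℕ → SignedSphere n} (hd : DenseRange d) (x : EuclideanSpace ℝ (Fin k → Fin n)) :
    IsLUB (Set.range fun i => processMean k β v₀ (d i) + ⟪processCoeff k (d i), x⟫)
      (opNorm (spiked β v₀ x.ofLp)) := by
  simp only [processMean_add_inner_processCoeff]
  have hcont : Continuous fun p : SignedSphere n =>
      p.sign * tinner (spiked β v₀ x.ofLp) (outerPow k p.vec) := by
    have := SignedSphere.continuous_sign (n := n)
    have := SignedSphere.continuous_vec (n := n)
    unfold tinner outerPow outer
    fun_prop
  refine (isLUB_iff_of_subset_of_subset_closure (Set.range_comp_subset_range d _) ?_).2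
    (isLUB_sign_mul_tinner_outerPow hk hn (permute_spiked β v₀ _))
  rw [Set.range_comp]
  exact hcont.range_subset_closure_image_dense hd

end SignedSphere

section SpikeValue

/-- The value `β tᵏ + k √(1 - t²)` of the limiting variational problem at correlation `t` with the
spike. The statement of the theorem parametrizes it by `t = τ / √(1 + τ²)`. -/
noncomputable def spikeValue (k : ℕ) (β t : ℝ) : ℝ := β * t ^ k + k * √(1 - t ^ 2)

theorem spikeValue_one (k : ℕ) (β : ℝ) : spikeValue k β 1 = β := by simp [spikeValue]

theorem div_sqrt_one_add_sq_mem_Icc {τ : ℝ} (hτ : 0 ≤ τ) :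
    τ / √(1 + τ ^ 2) ∈ Set.Icc (0 : ℝ) 1 :=
  ⟨by positivity, div_le_one_of_le₀ (Real.le_sqrt_of_sq_le (by linarith)) (Real.sqrt_nonneg _)⟩

theorem spikeValue_div_sqrt_one_add_sq (k : ℕ) (β τ : ℝ) :
    spikeValue k β (τ / √(1 + τ ^ 2)) = β * (τ / √(1 + τ ^ 2)) ^ k + k / √(1 + τ ^ 2) := by
  have hpos : 0 < 1 + τ ^ 2 := by positivity
  have hsqrt : √(1 - (τ / √(1 + τ ^ 2)) ^ 2) = (√(1 + τ ^ 2))⁻¹ := by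
    rw [div_pow, Real.sq_sqrt hpos.le, ← Real.sqrt_inv]
    congr 1
    field_simp
    ring
  rw [spikeValue, hsqrt, div_eq_mul_inv (k : ℝ)]

theorem exists_div_sqrt_one_add_sq_eq {t : ℝ} (ht₀ : 0 ≤ t) (ht₁ : t < 1) :
    ∃ τ, 0 ≤ τ ∧ τ / √(1 + τ ^ 2) = t := by
  have hpos : 0 < 1 - t ^ 2 := by nlinarith
  have hsqrt : √(1 + (t / √(1 - t ^ 2)) ^ 2) = (√(1 - t ^ 2))⁻¹ := by
    rw [div_pow, Real.sq_sqrt hpos.le, ← Real.sqrt_inv]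
    congr 1
    field_simp
    ring
  refine ⟨t / √(1 - t ^ 2), by positivity, ?_⟩
  rw [hsqrt, div_inv_eq_mul, div_mul_cancel₀ _ (Real.sqrt_pos.2 hpos).ne']

/- By Bernoulli's inequality the value at `t` is at least `β - k (β (1 - t) - √(1 - t²))`, and
`t = β² / (1 + β²)` makes the bracket nonpositive. -/
theorem exists_spikeValue_one_le (k : ℕ) {β : ℝ} (hβ : 0 ≤ β) :
    ∃ t, 0 ≤ t ∧ t < 1 ∧ spikeValue k β 1 ≤ spikeValue k β t := by
  have hpos : 0 < 1 + β ^ 2 := by positivity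
  set t := β ^ 2 / (1 + β ^ 2) with ht
  have ht₀ : 0 ≤ t := by positivity
  have hone_sub : 1 - t = 1 / (1 + β ^ 2) := by rw [ht]; field_simp; ring
  have hbernoulli : 1 + k * (t - 1) ≤ t ^ k := by
    simpa using one_add_mul_le_pow (a := t - 1) (by linarith) k
  have hsqrt : β * (1 - t) ≤ √(1 - t ^ 2) := by
    refine Real.le_sqrt_of_sq_le ?_
    have hβt : β ^ 2 * (1 - t) = t := by rw [hone_sub, ht]; ring
    have ht₁ : 0 ≤ 1 - t := by rw [hone_sub]; positivity
    calc (β * (1 - t)) ^ 2 = β ^ 2 * (1 - t) * (1 - t) := by ring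
      _ ≤ 1 - t ^ 2 := by rw [hβt]; nlinarith
  refine ⟨t, ht₀, by rw [ht, div_lt_one hpos]; linarith, ?_⟩
  calc spikeValue k β 1 = β * (1 + k * (t - 1)) + k * (β * (1 - t)) := by
        rw [spikeValue_one]
        ring
    _ ≤ spikeValue k β t := by
        unfold spikeValue
        gcongr

theorem exists_forall_spikeValue_le (k : ℕ) {β : ℝ} (hβ : 0 ≤ β) :
    ∃ t, 0 ≤ t ∧ t < 1 ∧ ∀ s ∈ Set.Icc (0 : ℝ) 1, spikeValue k β s ≤ spikeValue k β t := by
  have hcont : Continuous (spikeValue k β) := by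
    unfold spikeValue
    fun_prop
  obtain ⟨t, ht, hmax⟩ := isCompact_Icc.exists_isMaxOn
    (Set.nonempty_Icc.2 (zero_le_one (α := ℝ))) hcont.continuousOn
  rcases ht.2.lt_or_eq with ht₁ | rfl
  · exact ⟨t, ht.1, ht₁, hmax⟩
  · obtain ⟨t', ht'₀, ht'₁, hle⟩ := exists_spikeValue_one_le k hβ
    exact ⟨t', ht'₀, ht'₁, fun s hs => (hmax hs).trans hle⟩

theorem exists_isGreatest_spikeValue (k : ℕ) {β : ℝ} (hβ : 0 ≤ β) :
    ∃ M, IsGreatest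
        ((fun τ : ℝ => β * (τ / √(1 + τ ^ 2)) ^ k + k / √(1 + τ ^ 2)) '' Set.Ici 0) M ∧
      ∀ t ∈ Set.Icc (0 : ℝ) 1, spikeValue k β t ≤ M := by
  obtain ⟨t, ht₀, ht₁, hmax⟩ := exists_forall_spikeValue_le k hβ
  obtain ⟨τ, hτ, rfl⟩ := exists_div_sqrt_one_add_sq_eq ht₀ ht₁
  simp only [← spikeValue_div_sqrt_one_add_sq]
  refine ⟨_, ⟨⟨τ, hτ, rfl⟩, ?_⟩, hmax⟩
  rintro _ ⟨σ, hσ, rfl⟩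
  exact hmax _ (div_sqrt_one_add_sq_mem_Icc hσ)

end SpikeValue

section Comparison

theorem mul_one_sub_pow_le {σ ρ : ℝ} (hσ : σ ≤ 1) (hρ : |ρ| ≤ 1) (k : ℕ) :
    σ * (1 - ρ ^ k) ≤ k * (1 - ρ) := by
  have hρ₁ := neg_le_of_abs_le hρ
  have hpow : ρ ^ k ≤ 1 :=
    (le_abs_self _).trans (abs_pow ρ k ▸ pow_le_one₀ (abs_nonneg ρ) hρ)
  have hbernoulli : 1 + k * (ρ - 1) ≤ ρ ^ k := by
    simpa using one_add_mul_le_pow (a := ρ - 1) (by linarith) k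
  calc σ * (1 - ρ ^ k) ≤ 1 - ρ ^ k :=
        mul_le_of_le_one_left (by linarith) hσ
    _ ≤ k * (1 - ρ) := by linarith

variable {k n : ℕ}

/-- The coefficient vectors of the Gaussian process `p ↦ (k / √n) ⟨p.vec, y⟩ + p.sign * √(k / n) z`,
with `y` standard Gaussian in `ℝⁿ` and `z` an independent standard Gaussian variable, to which the
process with coefficients `processCoeff` is compared. -/
noncomputable def comparisonCoeff (k : ℕ) (p : SignedSphere n) :
    WithLp 2 (EuclideanSpace ℝ (Fin n) × ℝ) :=
  WithLp.toLp 2 (((k : ℝ) / √n) • p.vec, p.sign * √((k : ℝ) / n))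

theorem inner_processCoeff (p q : SignedSphere n) :
    ⟪processCoeff k p, processCoeff k q⟫ =
      p.sign * q.sign * ((k : ℝ) / n) * ⟪p.vec, q.vec⟫ ^ k := by
  have hsqrt : √((k : ℝ) / n) * √((k : ℝ) / n) = k / n := Real.mul_self_sqrt (by positivity)
  rw [processCoeff, processCoeff, real_inner_smul_left, real_inner_smul_right, ← tinner_eq_inner,
    outerPow, outerPow, tinner_outer_outer, Finset.prod_const, Finset.card_univ, Fintype.card_fin]
  linear_combination (p.sign * q.sign * ⟪p.vec, q.vec⟫ ^ k) * hsqrt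

theorem inner_comparisonCoeff (p q : SignedSphere n) :
    ⟪comparisonCoeff k p, comparisonCoeff k q⟫ =
      (k : ℝ) / n * (k * ⟪p.vec, q.vec⟫ + p.sign * q.sign) := by
  have hsqrt : √((k : ℝ) / n) * √((k : ℝ) / n) = k / n := Real.mul_self_sqrt (by positivity)
  have hdiv : (k : ℝ) / √n * (k / √n) = k / n * k := by
    rw [div_mul_div_comm, Real.mul_self_sqrt (by positivity)]
    ring
  simp only [comparisonCoeff, WithLp.prod_inner_apply, real_inner_smul_left, real_inner_smul_right,
    RCLike.inner_apply, conj_trivial]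
  linear_combination ⟪p.vec, q.vec⟫ * hdiv + p.sign * q.sign * hsqrt

theorem norm_processCoeff_sub_le (p q : SignedSphere n) :
    ‖processCoeff k p - processCoeff k q‖ ≤ ‖comparisonCoeff k p - comparisonCoeff k q‖ := by
  have hkey : 0 ≤ (k : ℝ) / n *
      (k * (1 - ⟪p.vec, q.vec⟫) - p.sign * q.sign * (1 - ⟪p.vec, q.vec⟫ ^ k)) :=
    mul_nonneg (by positivity) <| sub_nonneg.2 <|
      mul_one_sub_pow_le (le_of_abs_le (by rw [abs_mul, p.abs_sign, q.abs_sign, one_mul]))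
        (p.abs_inner_le q) k
  refine (pow_le_pow_iff_left₀ (norm_nonneg _) (norm_nonneg _) two_ne_zero).1 ?_
  rw [norm_sub_sq_real, norm_sub_sq_real]
  simp only [← real_inner_self_eq_norm_sq, inner_processCoeff, inner_comparisonCoeff]
  simp only [real_inner_self_eq_norm_sq, SignedSphere.norm_vec, one_pow]
  nlinarith

theorem inner_le_abs_inner_add {E : Type*} [NormedAddCommGroup E] [InnerProductSpace ℝ E]
    {v₀ v : E} (hv₀ : ‖v₀‖ = 1) (hv : ‖v‖ = 1) (y : E) :
    ⟪v, y⟫ ≤ |⟪v₀, y⟫| + √(1 - ⟪v₀, v⟫ ^ 2) * ‖y‖ := by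
  have hcoeff : |⟪v₀, v⟫| ≤ 1 := by simpa [hv₀, hv] using abs_real_inner_le_norm v₀ v
  have hnorm : ‖v - ⟪v₀, v⟫ • v₀‖ = √(1 - ⟪v₀, v⟫ ^ 2) := by
    rw [← Real.sqrt_sq (norm_nonneg _), norm_sub_sq_real, real_inner_smul_right, real_inner_comm,
      norm_smul, hv, hv₀, Real.norm_eq_abs, mul_one, sq_abs]
    ring_nf
  calc ⟪v, y⟫ = ⟪v₀, v⟫ * ⟪v₀, y⟫ + ⟪v - ⟪v₀, v⟫ • v₀, y⟫ := by
        rw [inner_sub_left, real_inner_smul_left]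
        ring
    _ ≤ |⟪v₀, y⟫| + ‖v - ⟪v₀, v⟫ • v₀‖ * ‖y‖ := by
        refine add_le_add ?_ (real_inner_le_norm _ _)
        refine (le_abs_self _).trans ?_
        rw [abs_mul]
        exact mul_le_of_le_one_left (abs_nonneg _) hcoeff
    _ = |⟪v₀, y⟫| + √(1 - ⟪v₀, v⟫ ^ 2) * ‖y‖ := by rw [hnorm]

theorem lipschitzWith_norm_fst {E F : Type*} [SeminormedAddCommGroup E]
    [SeminormedAddCommGroup F] : LipschitzWith 1 fun y : WithLp 2 (E × F) => ‖y.fst‖ :=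
  LipschitzWith.mk_one fun x y => (dist_norm_norm_le _ _).trans <| by
    rw [← dist_eq_norm]
    exact WithLp.dist_fst_le x y

section GaussianPair

variable {E F : Type*} [NormedAddCommGroup E] [InnerProductSpace ℝ E] [FiniteDimensional ℝ E]
  [MeasurableSpace E] [BorelSpace E] [NormedAddCommGroup F] [InnerProductSpace ℝ F]
  [FiniteDimensional ℝ F] [MeasurableSpace F] [BorelSpace F]

theorem integral_norm_fst_sq_stdGaussian :
    ∫ y, ‖y.fst‖ ^ 2 ∂stdGaussian (WithLp 2 (E × F)) = Module.finrank ℝ E := by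
  let b := stdOrthonormalBasis ℝ E
  let d (i : Fin (Module.finrank ℝ E)) : WithLp 2 (E × F) := WithLp.toLp 2 (b i, 0)
  have hexpand (y : WithLp 2 (E × F)) : ‖y.fst‖ ^ 2 = ∑ i, ⟪d i, y⟫ * ⟪d i, y⟫ := by
    rw [← b.sum_sq_norm_inner_right]
    simp [d, WithLp.prod_inner_apply, pow_two]
  have hnorm (i) : ⟪d i, d i⟫ = 1 := by simp [d]
  have hint (i) : Integrable (fun y => ⟪d i, y⟫ * ⟪d i, y⟫) (stdGaussian (WithLp 2 (E × F))) :=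
    (memLp_inner_stdGaussian (d i)).integrable_mul (memLp_inner_stdGaussian (d i))
  simp only [hexpand]
  rw [integral_finsetSum _ fun i _ => hint i]
  simp only [integral_inner_mul_inner_stdGaussian, hnorm, Finset.sum_const, Finset.card_univ,
    Fintype.card_fin, nsmul_eq_mul, mul_one]

theorem integral_norm_fst_stdGaussian_le :
    ∫ y, ‖y.fst‖ ∂stdGaussian (WithLp 2 (E × F)) ≤ √(Module.finrank ℝ E) := by
  have hmem : MemLp (fun y => ‖y.fst‖) 2 (stdGaussian (WithLp 2 (E × F))) :=
    memLp_two_stdGaussian_of_lipschitzWith lipschitzWith_norm_fst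
  have hvar := variance_nonneg (fun y => ‖y.fst‖) (stdGaussian (WithLp 2 (E × F)))
  rw [variance_eq_sub hmem, sub_nonneg] at hvar
  exact Real.le_sqrt_of_sq_le (hvar.trans_eq integral_norm_fst_sq_stdGaussian)

theorem integral_abs_sub_integral_stdGaussian_le {f : E → ℝ} (hf : LipschitzWith 1 f) :
    ∫ x, |f x - ∫ y, f y ∂stdGaussian E| ∂stdGaussian E ≤ 2 * Real.exp (1 / 2) :=
  integral_abs_le_of_hasSubgaussianMGF (by simpa using hasSubgaussianMGF_stdGaussian hf)

theorem integral_abs_inner_stdGaussian_le {w : E} (hw : ‖w‖ = 1) :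
    ∫ x, |⟪w, x⟫| ∂stdGaussian E ≤ 2 * Real.exp (1 / 2) := by
  have hlip : LipschitzWith 1 fun x => ⟪w, x⟫ := LipschitzWith.mk_one fun x y => by
    simpa [Real.dist_eq, ← inner_sub_right, hw, dist_eq_norm] using
      abs_real_inner_le_norm w (x - y)
  simpa [integral_inner_stdGaussian] using integral_abs_sub_integral_stdGaussian_le hlip

theorem integral_abs_inner_fst_stdGaussian_le {v : E} (hv : ‖v‖ = 1) :
    ∫ y, |⟪v, y.fst⟫| ∂stdGaussian (WithLp 2 (E × F)) ≤ 2 * Real.exp (1 / 2) := by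
  simpa using integral_abs_inner_stdGaussian_le (w := WithLp.toLp 2 (v, (0 : F))) (by simpa)

theorem integral_abs_snd_stdGaussian_le :
    ∫ y, |y.snd| ∂stdGaussian (WithLp 2 (E × ℝ)) ≤ 2 * Real.exp (1 / 2) := by
  simpa using integral_abs_inner_stdGaussian_le (w := WithLp.toLp 2 ((0 : E), (1 : ℝ))) (by simp)

theorem integrable_abs_inner_fst_stdGaussian (v : E) :
    Integrable (fun y => |⟪v, y.fst⟫|) (stdGaussian (WithLp 2 (E × F))) := by
  simpa using
    ((memLp_inner_stdGaussian (WithLp.toLp 2 (v, (0 : F)))).integrable one_le_two).abs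

theorem integrable_abs_snd_stdGaussian :
    Integrable (fun y => |y.snd|) (stdGaussian (WithLp 2 (E × ℝ))) := by
  simpa using
    ((memLp_inner_stdGaussian (WithLp.toLp 2 ((0 : E), (1 : ℝ)))).integrable one_le_two).abs

theorem integrable_abs_norm_fst_sub_stdGaussian (c : ℝ) :
    Integrable (fun y => |‖y.fst‖ - c|) (stdGaussian (WithLp 2 (E × F))) :=
  (((memLp_two_stdGaussian_of_lipschitzWith lipschitzWith_norm_fst).integrable one_le_two).sub
    (integrable_const c)).abs

end GaussianPair

/-- The joint law of a standard Gaussian vector in `ℝⁿ` and an independent standard Gaussian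
variable. -/
noncomputable abbrev gaussianPair (n : ℕ) : Measure (WithLp 2 (EuclideanSpace ℝ (Fin n) × ℝ)) :=
  stdGaussian _

/-- A bound for the comparison process that is uniform in its index: the maximal mean `M` plus
fluctuations of order `1 / √n`. -/
noncomputable def comparisonBound (k : ℕ) (M : ℝ) (v₀ : EuclideanSpace ℝ (Fin n))
    (y : WithLp 2 (EuclideanSpace ℝ (Fin n) × ℝ)) : ℝ :=
  M + (k : ℝ) / √n * (|⟪v₀, y.fst⟫| + |‖y.fst‖ - ∫ y', ‖y'.fst‖ ∂gaussianPair n|) +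
    √((k : ℝ) / n) * |y.snd|

variable {β M : ℝ} {v₀ : EuclideanSpace ℝ (Fin n)}

theorem processMean_le (hβ : 0 ≤ β) (p : SignedSphere n) :
    processMean k β v₀ p ≤ β * |⟪v₀, p.vec⟫| ^ k := by
  refine (le_abs_self _).trans_eq ?_
  rw [processMean, abs_mul, p.abs_sign, one_mul, abs_mul, abs_of_nonneg hβ, abs_pow]

theorem inner_comparisonCoeff_le (hv₀ : ‖v₀‖ = 1) (p : SignedSphere n)
    (y : WithLp 2 (EuclideanSpace ℝ (Fin n) × ℝ)) :
    ⟪comparisonCoeff k p, y⟫ ≤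
      (k : ℝ) / √n * (|⟪v₀, y.fst⟫| + √(1 - ⟪v₀, p.vec⟫ ^ 2) * ‖y.fst‖) +
        √((k : ℝ) / n) * |y.snd| := by
  have hsnd : p.sign * y.snd ≤ |y.snd| := by
    simpa [abs_mul, p.abs_sign] using le_abs_self (p.sign * y.snd)
  calc ⟪comparisonCoeff k p, y⟫
      = (k : ℝ) / √n * ⟪p.vec, y.fst⟫ + √((k : ℝ) / n) * (p.sign * y.snd) := by
        simp [comparisonCoeff, real_inner_smul_left]
        ring
    _ ≤ _ := by
        gcongr
        exact inner_le_abs_inner_add hv₀ p.norm_vec y.fst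

theorem processMean_add_inner_comparisonCoeff_le (hβ : 0 ≤ β)
    (hM : ∀ t ∈ Set.Icc (0 : ℝ) 1, spikeValue k β t ≤ M) (hv₀ : ‖v₀‖ = 1)
    (p : SignedSphere n) (y : WithLp 2 (EuclideanSpace ℝ (Fin n) × ℝ)) :
    processMean k β v₀ p + ⟪comparisonCoeff k p, y⟫ ≤ comparisonBound k M v₀ y := by
  set ρ := ⟪v₀, p.vec⟫
  set m := ∫ y', ‖y'.fst‖ ∂gaussianPair n
  have hρ : |ρ| ≤ 1 := by simpa [hv₀, p.norm_vec] using abs_real_inner_le_norm v₀ p.vec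
  have hsqrt : √(1 - ρ ^ 2) ≤ 1 := Real.sqrt_le_one.2 (by linarith [sq_nonneg ρ])
  have hm : m ≤ √n := by
    simpa using integral_norm_fst_stdGaussian_le (E := EuclideanSpace ℝ (Fin n)) (F := ℝ)
  have hmean : (k : ℝ) / √n * (√(1 - ρ ^ 2) * m) ≤ k * √(1 - ρ ^ 2) := by
    rw [div_mul_eq_mul_div]
    refine div_le_of_le_mul₀ (Real.sqrt_nonneg _) (by positivity) ?_
    rw [mul_assoc]
    gcongr
  have hfluct : √(1 - ρ ^ 2) * (‖y.fst‖ - m) ≤ |‖y.fst‖ - m| := by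
    refine (le_abs_self _).trans ?_
    rw [abs_mul, abs_of_nonneg (Real.sqrt_nonneg _)]
    exact mul_le_of_le_one_left (abs_nonneg _) hsqrt
  have hmax := hM |ρ| ⟨abs_nonneg ρ, hρ⟩
  rw [spikeValue, sq_abs] at hmax
  calc processMean k β v₀ p + ⟪comparisonCoeff k p, y⟫
      ≤ β * |ρ| ^ k + ((k : ℝ) / √n * (|⟪v₀, y.fst⟫| + √(1 - ρ ^ 2) * ‖y.fst‖) +
          √((k : ℝ) / n) * |y.snd|) :=
        add_le_add (processMean_le hβ p) (inner_comparisonCoeff_le hv₀ p y)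
    _ = β * |ρ| ^ k + (k : ℝ) / √n * (√(1 - ρ ^ 2) * m) +
          (k : ℝ) / √n * (|⟪v₀, y.fst⟫| + √(1 - ρ ^ 2) * (‖y.fst‖ - m)) +
          √((k : ℝ) / n) * |y.snd| := by ring
    _ ≤ comparisonBound k M v₀ y := by
        unfold comparisonBound
        gcongr
        linarith

theorem integrable_comparisonBound (k : ℕ) (M : ℝ) (v₀ : EuclideanSpace ℝ (Fin n)) :
    Integrable (comparisonBound k M v₀) (gaussianPair n) :=
  ((integrable_const M).add (((integrable_abs_inner_fst_stdGaussian v₀).add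
    (integrable_abs_norm_fst_sub_stdGaussian _)).const_mul _)).add
    (integrable_abs_snd_stdGaussian.const_mul _)

theorem integral_comparisonBound_eq (k : ℕ) (M : ℝ) (v₀ : EuclideanSpace ℝ (Fin n)) :
    ∫ y, comparisonBound k M v₀ y ∂gaussianPair n =
      M + (k : ℝ) / √n * (∫ y, |⟪v₀, y.fst⟫| ∂gaussianPair n +
        ∫ y, |‖y.fst‖ - ∫ y', ‖y'.fst‖ ∂gaussianPair n| ∂gaussianPair n) +
        √((k : ℝ) / n) * ∫ y, |y.snd| ∂gaussianPair n := by
  have hinner := integrable_abs_inner_fst_stdGaussian (F := ℝ) v₀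
  have hnorm := integrable_abs_norm_fst_sub_stdGaussian (E := EuclideanSpace ℝ (Fin n)) (F := ℝ)
    (∫ y', ‖y'.fst‖ ∂gaussianPair n)
  have hsnd := integrable_abs_snd_stdGaussian (E := EuclideanSpace ℝ (Fin n))
  have hmain : Integrable (fun y => (k : ℝ) / √n * (|⟪v₀, y.fst⟫| +
      |‖y.fst‖ - ∫ y', ‖y'.fst‖ ∂gaussianPair n|)) (gaussianPair n) :=
    (hinner.add hnorm).const_mul _
  have hconst : Integrable (fun _ => M) (gaussianPair n) := integrable_const M
  unfold comparisonBound
  rw [integral_add (by exact hconst.add hmain) (hsnd.const_mul _), integral_add hconst hmain,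
    integral_const_mul, integral_const_mul, integral_add hinner hnorm]
  simp

theorem integral_comparisonBound_le (k : ℕ) (M : ℝ) (hv₀ : ‖v₀‖ = 1) :
    ∫ y, comparisonBound k M v₀ y ∂gaussianPair n ≤
      M + 2 * Real.exp (1 / 2) * (2 * k + √k) / √n := by
  rw [integral_comparisonBound_eq]
  calc _ ≤ M + (k : ℝ) / √n * (2 * Real.exp (1 / 2) + 2 * Real.exp (1 / 2)) +
        √((k : ℝ) / n) * (2 * Real.exp (1 / 2)) := by
        gcongr
        · exact integral_abs_inner_fst_stdGaussian_le hv₀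
        · exact integral_abs_sub_integral_stdGaussian_le lipschitzWith_norm_fst
        · exact integral_abs_snd_stdGaussian_le
    _ = M + 2 * Real.exp (1 / 2) * (2 * k + √k) / √n := by
        rw [Real.sqrt_div (by positivity)]
        ring

theorem integral_opNorm_spiked_le (hk : 1 ≤ k) (hn : 1 ≤ n) (hβ : 0 ≤ β)
    (hM : ∀ t ∈ Set.Icc (0 : ℝ) 1, spikeValue k β t ≤ M) (hv₀ : ‖v₀‖ = 1) :
    ∫ x : EuclideanSpace ℝ (Fin k → Fin n), opNorm (spiked β v₀ x.ofLp) ∂stdGaussian _ ≤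
      M + 2 * Real.exp (1 / 2) * (2 * k + √k) / √n := by
  have := SignedSphere.nonempty hn
  let d := TopologicalSpace.denseSeq (SignedSphere n)
  refine le_trans ?_ (integral_comparisonBound_le k M hv₀)
  exact sudakov_fernique_of_isLUB (fun i => processMean k β v₀ (d i))
    (fun i j => norm_processCoeff_sub_le (d i) (d j))
    (isLUB_opNorm_spiked hk hn β v₀ (TopologicalSpace.denseRange_denseSeq _))
    (fun y i => processMean_add_inner_comparisonCoeff_le hβ hM hv₀ (d i) y)
    ((memLp_two_stdGaussian_of_lipschitzWith (lipschitzWith_opNorm_spiked β v₀)).integrable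
      one_le_two)
    (integrable_comparisonBound k M v₀)

end Comparison

section RandomTensor

variable {k n : ℕ} {Ω : Type*} [MeasurableSpace Ω] {P : Measure Ω} {G : Ω → Tensor k n}

theorem IsStdGaussianTensor.hasLaw_toLp (hG : IsStdGaussianTensor G P) :
    HasLaw (fun ω => WithLp.toLp 2 (G ω)) (stdGaussian (EuclideanSpace ℝ (Fin k → Fin n))) P :=
  HasLaw.fun_comp ⟨by fun_prop, map_pi_eq_stdGaussian⟩ (hG.2.hasLaw_pi hG.1)

theorem integral_opNorm_spiked_eq (hG : IsStdGaussianTensor G P) (β : ℝ)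
    (v₀ : EuclideanSpace ℝ (Fin n)) :
    ∫ ω, opNorm (spiked β v₀ (G ω)) ∂P =
      ∫ x : EuclideanSpace ℝ (Fin k → Fin n), opNorm (spiked β v₀ x.ofLp) ∂stdGaussian _ :=
  hG.hasLaw_toLp.integral_comp
    (lipschitzWith_opNorm_spiked β v₀).continuous.aestronglyMeasurable

theorem hasSubgaussianMGF_opNorm_spiked (hG : IsStdGaussianTensor G P)
    (β : ℝ) (v₀ : EuclideanSpace ℝ (Fin n)) :
    HasSubgaussianMGF
      (fun ω => opNorm (spiked β v₀ (G ω)) - ∫ ω', opNorm (spiked β v₀ (G ω')) ∂P) (k / n) P := by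
  have h := hasSubgaussianMGF_stdGaussian (lipschitzWith_opNorm_spiked (k := k) β v₀)
  rw [NNReal.sq_sqrt, ← integral_opNorm_spiked_eq hG, ← hG.hasLaw_toLp.map_eq] at h
  exact h.of_map hG.hasLaw_toLp.aemeasurable

theorem integrable_opNorm_spiked (hG : IsStdGaussianTensor G P) (β : ℝ)
    (v₀ : EuclideanSpace ℝ (Fin n)) : Integrable (fun ω => opNorm (spiked β v₀ (G ω))) P := by
  have := hG.hasLaw_toLp.isProbabilityMeasure
  simpa [Pi.add_def] using (hasSubgaussianMGF_opNorm_spiked hG β v₀).integrable.add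
    (integrable_const (∫ ω', opNorm (spiked β v₀ (G ω')) ∂P))

end RandomTensor

theorem limsup_coe_le_of_eventually_le_add_div_sqrt {u : ℕ → ℝ} {M C : ℝ}
    (hu : ∀ᶠ n in Filter.atTop, u n ≤ M + C / √n) :
    Filter.limsup (fun n => (u n : EReal)) Filter.atTop ≤ M := by
  have hlim : Filter.Tendsto (fun n : ℕ => ((M + C / √n : ℝ) : EReal)) Filter.atTop (𝓝 M) := by
    refine (continuous_coe_real_ereal.tendsto M).comp ?_
    simpa using ((Real.tendsto_sqrt_atTop.comp
      tendsto_natCast_atTop_atTop).const_div_atTop C).const_add M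
  rw [← hlim.limsup_eq]
  refine Filter.limsup_le_limsup ?_
  filter_upwards [hu] with n hn using EReal.coe_le_coe_iff.2 hn

end SpikedTensor

theorem mainTheorem9 (k : ℕ) (hk : 1 ≤ k) (β : ℝ) (hβ : 0 ≤ β)
    (v₀ : ∀ n : ℕ, EuclideanSpace ℝ (Fin n)) (hv₀ : ∀ n, 1 ≤ n → ‖v₀ n‖ = 1)
    {Ω : ℕ → Type*} [∀ n, MeasurableSpace (Ω n)]
    (P : ∀ n, Measure (Ω n)) [∀ n, IsProbabilityMeasure (P n)]
    (G : ∀ n, Ω n → SpikedTensor.Tensor k n)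
    (hG : ∀ n, 1 ≤ n → SpikedTensor.IsStdGaussianTensor (G n) (P n)) :
    (∀ n, 1 ≤ n →
      Integrable (fun ω => SpikedTensor.opNorm (SpikedTensor.spiked β (v₀ n) (G n ω))) (P n)) ∧
    (∃ M : ℝ,
      IsGreatest ((fun τ : ℝ => β * (τ / √(1 + τ ^ 2)) ^ k + k / √(1 + τ ^ 2)) '' Set.Ici 0) M ∧
      Filter.limsup
        (fun n : ℕ =>
          ((∫ ω, SpikedTensor.opNorm (SpikedTensor.spiked β (v₀ n) (G n ω)) ∂(P n) : ℝ) : EReal))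
        Filter.atTop ≤ (M : EReal)) ∧
    (∀ n : ℕ, 1 ≤ n → ∀ s : ℝ, 0 ≤ s →
      (P n).real {ω | s ≤ |SpikedTensor.opNorm (SpikedTensor.spiked β (v₀ n) (G n ω)) -
          ∫ ω', SpikedTensor.opNorm (SpikedTensor.spiked β (v₀ n) (G n ω')) ∂(P n)|} ≤
        2 * Real.exp (-(n * s ^ 2 / (2 * k)))) := by
  obtain ⟨M, hM, hMt⟩ := SpikedTensor.exists_isGreatest_spikeValue k hβ
  refine ⟨fun n hn => SpikedTensor.integrable_opNorm_spiked (hG n hn) β (v₀ n), ⟨M, hM, ?_⟩,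
    fun n hn s hs => ?_⟩
  · refine SpikedTensor.limsup_coe_le_of_eventually_le_add_div_sqrt
      (C := 2 * Real.exp (1 / 2) * (2 * k + √k)) ?_
    filter_upwards [Filter.eventually_ge_atTop 1] with n hn
    rw [SpikedTensor.integral_opNorm_spiked_eq (hG n hn)]
    exact SpikedTensor.integral_opNorm_spiked_le hk hn hβ hMt (hv₀ n hn)
  · have hsub := SpikedTensor.hasSubgaussianMGF_opNorm_spiked (hG n hn) β (v₀ n)
    refine (SpikedTensor.measureReal_le_abs_of_hasSubgaussianMGF hsub hs).trans_eq ?_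
    simp only [NNReal.coe_div, NNReal.coe_natCast]
    congr 2
    field_simp
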